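/- Let $p,p_1,p_2\ge 0$ be integers, let $W_1^*\in\mathbb R^{p_1\times p}$, $W_2^*\in\mathbb R^{p_2\times p_1}$ be fixed (teacher) matrices, and let $(\alpha_t)_{t\ge 0}$ be real step sizes. For a mini-batch size $b\ge 1$, let $x_{t,i}$ ($t\ge 0$, $1\le i\le b$) be i.i.d. $\mathcal N(0,I_p)$, independent of the (possibly random) initial weights $W_{0,1}^b=W_{0,1}\in\mathbb R^{p_1\times p}$, $W_{0,2}^b=W_{0,2}\in\mathbb R^{p_2\times p_1}$, and let $$W_{t+1,j}^b=W_{t,j}^b-\alpha_t\,\frac1b\sum_{i=1}^b\nabla_{W_j}\Big(\tfrac12\|W_2W_1x_{t,i}-W_2^*W_1^*x_{t,i}\|^2\Big)\Big|_{(W_1,W_2)=(W_{t,1}^b,W_{t,2}^b)},\qquad j=1,2 .$$ Put $\mathcal W_t^b=W_{t,2}^bW_{t,1}^b-W_2^*W_1^*$ and $\mathcal F_0=\sigma(W_{0,1},W_{0,2})$. A *multiplicative term* of parameter matrices $\mathcal X$ and constant matrices $\mathcal C$ is a formal product $A_1\cdots A_k$ ($k\ge 0$) of factors of compatible sizes,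 each a member of $\mathcal X\cup\mathcal C$ or the transpose of one; the empty product is an identity matrix. The degree $\deg(X;M)$ of $X\in\mathcal X$ in $M$ is the number of factors that are $X$ or $X^\top$, and $\deg(M)=\sum_{X\in\mathcal X}\deg(X;M)$. Given $t\ge 0$, let $M_0,\dots,M_m$ ($m\ge 0$) be multiplicative terms of parameter matrices $\{W_{t,1}^b,W_{t,2}^b,\mathcal W_t^b\}$ and constant matrices $\{W_1^*,W_2^*\}$, with $M_1,\dots,M_m$ square. Let $$M=\prod_{i=1}^m\operatorname{tr}(M_i)\,M_0,\quad d=\sum_{i=0}^m\big(\deg(W_{t,1}^b;M_i)+\deg(W_{t,2}^b;M_i)\big),\quad d'=\sum_{i=0}^m\deg(\mathcal W_t^b;M_i).$$ Then there are an integer $q\le 3^t(d+2d')$, integers $m_k,m_{ki}\ge 0$, real numbers $a_{ki}$, and multiplicative terms $M_{ij}^k$ ($0\le k\le q$, $1\le i\le m_k$, $0\le j\le m_{ki}$) of parameter matrices $\{W_{0,1},W_{0,2}\}$ and constant matrices $\{W_1^*,W_2^*\}$, with $$\sum_{j=0}^{m_{ki}}\deg(M_{ij}^k)\le 3^t(d+2d')\qquad\text{for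 all }k,i,$$ all of these depending only on $t$, on $p,p_1,p_2$, on the step sizes and on the formal terms $M_0,\dots,M_m$ (and not on $b$, on the initial or teacher weights, or on the probability space), such that $$\mathbb E[M\mid\mathcal F_0]=N_0+N_1\frac1b+\dots+N_q\frac1{b^q}\quad\text{a.s.},\qquad N_k=\sum_{i=1}^{m_k}a_{ki}\prod_{j=1}^{m_{ki}}\operatorname{tr}(M_{ij}^k)\,M_{i0}^k .$$ Here the conditional expectation is taken entrywise, and the equality is asserted for each entry of $M$ that is integrable. If all entries of $W_{0,1},W_{0,2}$ have finite moments of every order (for example, if the initial weights are deterministic), then every entry of $M$ is integrable. -/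

import Mathlib

open MeasureTheory ProbabilityTheory

/-! ## Multiplicative terms -/

/-- A single factor `X`, `Xᵀ`, `C` or `Cᵀ` of a multiplicative term, as a formal symbol of size
`m × n`. The parameter symbols `x : 𝒳` and the constant symbols `c : 𝒞` carry the sizes `σ x` and
`τ c`. Two symbols of compatible numerical size may always be multiplied. -/
inductive MulFactor {𝒳 𝒞 : Type} (σ : 𝒳 → ℕ × ℕ) (τ : 𝒞 → ℕ × ℕ) : ℕ → ℕ → Type
  | param (x : 𝒳) : MulFactor σ τ (σ x).1 (σ x).2
  | paramT (x : 𝒳) : MulFactor σ τ (σ x).2 (σ x).1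
  | const (c : 𝒞) : MulFactor σ τ (τ c).1 (τ c).2
  | constT (c : 𝒞) : MulFactor σ τ (τ c).2 (τ c).1

/-- A multiplicative term of size `m × n`: a formal product `A₁ A₂ ⋯ A_k` of factors of compatible
sizes. The empty product is an identity matrix. -/
inductive MulTerm {𝒳 𝒞 : Type} (σ : 𝒳 → ℕ × ℕ) (τ : 𝒞 → ℕ × ℕ) : ℕ → ℕ → Type
  | one (n : ℕ) : MulTerm σ τ n n
  | mul {m k n : ℕ} (A : MulFactor σ τ m k) (M : MulTerm σ τ k n) : MulTerm σ τ m n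

section

variable {𝒳 𝒞 : Type} {σ : 𝒳 → ℕ × ℕ} {τ : 𝒞 → ℕ × ℕ}

/-- The matrix that a factor denotes, given matrices for all symbols. -/
def MulFactor.eval (X : ∀ x, Matrix (Fin (σ x).1) (Fin (σ x).2) ℝ)
    (C : ∀ c, Matrix (Fin (τ c).1) (Fin (τ c).2) ℝ) :
    ∀ {m n : ℕ}, MulFactor σ τ m n → Matrix (Fin m) (Fin n) ℝ
  | _, _, .param x => X x
  | _, _, .paramT x => (X x).transpose
  | _, _, .const c => C c
  | _, _, .constT c => (C c).transpose

/-- Whether a factor is the parameter `x` or its transpose (1), or not (0). -/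
def MulFactor.degOf [DecidableEq 𝒳] (x : 𝒳) : ∀ {m n : ℕ}, MulFactor σ τ m n → ℕ
  | _, _, .param y => if y = x then 1 else 0
  | _, _, .paramT y => if y = x then 1 else 0
  | _, _, .const _ => 0
  | _, _, .constT _ => 0

/-- Whether a factor is a parameter or the transpose of one (1), or not (0). -/
def MulFactor.degree : ∀ {m n : ℕ}, MulFactor σ τ m n → ℕ
  | _, _, .param _ => 1
  | _, _, .paramT _ => 1
  | _, _, .const _ => 0
  | _, _, .constT _ => 0

/-- The matrix that a multiplicative term denotes: the product of its factors. -/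
def MulTerm.eval (X : ∀ x, Matrix (Fin (σ x).1) (Fin (σ x).2) ℝ)
    (C : ∀ c, Matrix (Fin (τ c).1) (Fin (τ c).2) ℝ) :
    ∀ {m n : ℕ}, MulTerm σ τ m n → Matrix (Fin m) (Fin n) ℝ
  | _, _, .one _ => 1
  | _, _, .mul A M => A.eval X C * M.eval X C

/-- `deg(x; M)`: the number of appearances of the parameter `x` and of its transpose. -/
def MulTerm.degOf [DecidableEq 𝒳] (x : 𝒳) : ∀ {m n : ℕ}, MulTerm σ τ m n → ℕ
  | _, _, .one _ => 0
  | _, _, .mul A M => A.degOf x + M.degOf x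

/-- `deg(M)`: the number of appearances of all parameters and their transposes. -/
def MulTerm.degree : ∀ {m n : ℕ}, MulTerm σ τ m n → ℕ
  | _, _, .one _ => 0
  | _, _, .mul A M => A.degree + M.degree

end

/-- A trace-product `tr(M₁) ⋯ tr(M_m) M₀` of size `r × s`: finitely many square multiplicative terms
under the trace (possibly none), and one further multiplicative term of size `r × s`. -/
structure TraceProduct {𝒳 𝒞 : Type} (σ : 𝒳 → ℕ × ℕ) (τ : 𝒞 → ℕ × ℕ) (r s : ℕ) where
  traced : List (Σ n : ℕ, MulTerm σ τ n n)
  last : MulTerm σ τ r s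

namespace TraceProduct

variable {𝒳 𝒞 : Type} {σ : 𝒳 → ℕ × ℕ} {τ : 𝒞 → ℕ × ℕ} {r s : ℕ}

/-- The matrix `tr(M₁) ⋯ tr(M_m) M₀`. -/
def eval (X : ∀ x, Matrix (Fin (σ x).1) (Fin (σ x).2) ℝ)
    (C : ∀ c, Matrix (Fin (τ c).1) (Fin (τ c).2) ℝ) (T : TraceProduct σ τ r s) :
    Matrix (Fin r) (Fin s) ℝ :=
  (T.traced.map fun M => (M.2.eval X C).trace).prod • T.last.eval X C

/-- The degree of the parameter `x`, summed over `M₀, …, M_m`. -/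
def degOf [DecidableEq 𝒳] (x : 𝒳) (T : TraceProduct σ τ r s) : ℕ :=
  (T.traced.map fun M => M.2.degOf x).sum + T.last.degOf x

/-- The total degree `deg(M₀) + ⋯ + deg(M_m)`. -/
def degree (T : TraceProduct σ τ r s) : ℕ :=
  (T.traced.map fun M => M.2.degree).sum + T.last.degree

end TraceProduct

/-! ## Weights of the two-layer linear network -/

/-- A pair `(W₁, W₂)` with `W₁ ∈ ℝ^{p₁ × p}` and `W₂ ∈ ℝ^{p₂ × p₁}`. -/
abbrev Weights (p p₁ p₂ : ℕ) : Type :=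
  Matrix (Fin p₁) (Fin p) ℝ × Matrix (Fin p₂) (Fin p₁) ℝ

/-- The product (Borel) σ-algebra on matrices. -/
instance matrixMeasurableSpace {m n : ℕ} : MeasurableSpace (Matrix (Fin m) (Fin n) ℝ) :=
  MeasurableSpace.pi

/-- The symbols for the two layers. -/
inductive Layer
  | one
  | two
  deriving DecidableEq

/-- The symbols for the two weight matrices and for the gap. -/
inductive LayerOrGap
  | one
  | two
  | gap
  deriving DecidableEq

/-- The sizes of `W₁`, `W₂`. -/
def layerSize (p p₁ p₂ : ℕ) : Layer → ℕ × ℕ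
  | .one => (p₁, p)
  | .two => (p₂, p₁)

/-- The sizes of `W₁`, `W₂` and of the gap. -/
def layerOrGapSize (p p₁ p₂ : ℕ) : LayerOrGap → ℕ × ℕ
  | .one => (p₁, p)
  | .two => (p₂, p₁)
  | .gap => (p₂, p)

section

variable {p p₁ p₂ : ℕ}

/-- The gap `𝒲 = W₂ W₁ - W₂* W₁*` between student weights `w` and teacher weights `v`. -/
def gap (v w : Weights p p₁ p₂) : Matrix (Fin p₂) (Fin p) ℝ :=
  w.2 * w.1 - v.2 * v.1

/-- The values of the symbols for the two layers. -/
def layerValue (w : Weights p p₁ p₂) :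
    ∀ l, Matrix (Fin (layerSize p p₁ p₂ l).1) (Fin (layerSize p p₁ p₂ l).2) ℝ
  | .one => w.1
  | .two => w.2

/-- The values of the symbols for the two layers and the gap, for teacher weights `v` and student
weights `w`. -/
def layerOrGapValue (v w : Weights p p₁ p₂) :
    ∀ l, Matrix (Fin (layerOrGapSize p p₁ p₂ l).1) (Fin (layerOrGapSize p p₁ p₂ l).2) ℝ
  | .one => w.1
  | .two => w.2
  | .gap => gap v w

/-! ## Online mini-batch SGD -/

/-- The loss `½ ‖W₂ W₁ x - W₂* W₁* x‖²` of student weights `w` on a sample `x`, for teacher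
weights `v`. -/
noncomputable def sampleLoss (v w : Weights p p₁ p₂) (x : EuclideanSpace ℝ (Fin p)) : ℝ :=
  (1 / 2) * ‖Matrix.toEuclideanLin (w.2 * w.1) x - Matrix.toEuclideanLin (v.2 * v.1) x‖ ^ 2

/-- The gradient of the sample loss in `W₁`: its entries are the partial derivatives. -/
noncomputable def sampleGrad₁ (v w : Weights p p₁ p₂) (x : EuclideanSpace ℝ (Fin p)) :
    Matrix (Fin p₁) (Fin p) ℝ :=
  Matrix.of fun i j =>
    deriv (fun h : ℝ => sampleLoss v (w.1 + Matrix.single i j h, w.2) x) 0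

/-- The gradient of the sample loss in `W₂`: its entries are the partial derivatives. -/
noncomputable def sampleGrad₂ (v w : Weights p p₁ p₂) (x : EuclideanSpace ℝ (Fin p)) :
    Matrix (Fin p₂) (Fin p₁) ℝ :=
  Matrix.of fun i j =>
    deriv (fun h : ℝ => sampleLoss v (w.1, w.2 + Matrix.single i j h) x) 0

theorem deriv_half_norm_sq_line {n : ℕ} (A B : EuclideanSpace ℝ (Fin n)) :
    deriv (fun h : ℝ => (1 / 2) * ‖A + h • B‖ ^ 2) 0 = inner ℝ A B := by
  have h1 : HasDerivAt (fun h : ℝ => A + h • B) B 0 := by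
    simpa using ((hasDerivAt_id (0 : ℝ)).smul_const B).const_add A
  have h2 := (h1.norm_sq).const_mul (1 / 2 : ℝ)
  rw [h2.deriv]
  simp

/-- `∇_{W₁} = W₂ᵀ 𝒲 x xᵀ`. -/
theorem sampleGrad₁_eq (v w : Weights p p₁ p₂) (x : EuclideanSpace ℝ (Fin p)) :
    sampleGrad₁ v w x =
      w.2.transpose * gap v w * Matrix.vecMulVec (WithLp.ofLp x) (WithLp.ofLp x) := by
  ext i j
  have key : ∀ h : ℝ, sampleLoss v (w.1 + Matrix.single i j h, w.2) x =
      (1 / 2) * ‖Matrix.toEuclideanLin (gap v w) x +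
        h • Matrix.toEuclideanLin (w.2 * Matrix.single i j (1 : ℝ)) x‖ ^ 2 := by
    intro h
    have hs : (Matrix.single i j h : Matrix (Fin p₁) (Fin p) ℝ) = h • Matrix.single i j 1 := by
      simp [Matrix.smul_single]
    simp only [sampleLoss, gap, hs, Matrix.mul_add, map_add, map_sub, Matrix.mul_smul, map_smul,
      LinearMap.add_apply, LinearMap.sub_apply, LinearMap.smul_apply]
    congr 3
    exact add_sub_right_comm _ _ _
  simp only [sampleGrad₁, Matrix.of_apply, key, deriv_half_norm_sq_line]
  simp only [PiLp.inner_apply, Matrix.toLpLin_apply, RCLike.inner_apply, conj_trivial,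
    ← Matrix.mulVec_mulVec, Matrix.mul_vecMulVec, Matrix.vecMulVec_apply]
  simp [Matrix.mulVec, dotProduct, Matrix.single_apply, ite_and, mul_assoc, mul_comm]
  rw [← Finset.mul_sum]

/-- `∇_{W₂} = 𝒲 x xᵀ W₁ᵀ`. -/
theorem sampleGrad₂_eq (v w : Weights p p₁ p₂) (x : EuclideanSpace ℝ (Fin p)) :
    sampleGrad₂ v w x =
      gap v w * Matrix.vecMulVec (WithLp.ofLp x) (WithLp.ofLp x) * w.1.transpose := by
  ext i j
  have key : ∀ h : ℝ, sampleLoss v (w.1, w.2 + Matrix.single i j h) x =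
      (1 / 2) * ‖Matrix.toEuclideanLin (gap v w) x +
        h • Matrix.toEuclideanLin (Matrix.single i j (1 : ℝ) * w.1) x‖ ^ 2 := by
    intro h
    have hs : (Matrix.single i j h : Matrix (Fin p₂) (Fin p₁) ℝ) = h • Matrix.single i j 1 := by
      simp [Matrix.smul_single]
    simp only [sampleLoss, gap, hs, Matrix.add_mul, map_add, map_sub, Matrix.smul_mul, map_smul,
      LinearMap.add_apply, LinearMap.sub_apply, LinearMap.smul_apply]
    congr 3
    exact add_sub_right_comm _ _ _
  simp only [sampleGrad₂, Matrix.of_apply, key, deriv_half_norm_sq_line]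
  simp only [PiLp.inner_apply, Matrix.toLpLin_apply, RCLike.inner_apply, conj_trivial,
    ← Matrix.mulVec_mulVec, Matrix.mul_vecMulVec, Matrix.vecMulVec_mul,
    Matrix.vecMulVec_apply]
  simp [Matrix.mulVec, dotProduct, Matrix.vecMul, Matrix.single_apply, ite_and, mul_comm]

/-- The weights `(W_{t,1}, W_{t,2})` after `t` steps of online SGD with step sizes `α`, teacher
weights `v`, initial weights `w₀` and mini-batches `x t 0, …, x t (b - 1)`. -/
noncomputable def sgdWeights {b : ℕ} (α : ℕ → ℝ) (v w₀ : Weights p p₁ p₂)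
    (x : ℕ → Fin b → EuclideanSpace ℝ (Fin p)) : ℕ → Weights p p₁ p₂
  | 0 => w₀
  | t + 1 =>
    let w := sgdWeights α v w₀ x t
    (w.1 - α t • ((1 / (b : ℝ)) • ∑ i, sampleGrad₁ v w (x t i)),
      w.2 - α t • ((1 / (b : ℝ)) • ∑ i, sampleGrad₂ v w (x t i)))

end

/-! A gradient step sees its batch only through the second moment G = (1/b) ∑ xxᵀ: W₁ moves by a
multiple of W₂ᵀ𝒲G and W₂ by a multiple of 𝒲GW₁ᵀ. Substituting this into a trace-product of degree at
most D in the new weights gives a combination of trace-products with at most 3D old weights and at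
most D factors G. The current weights are independent of the batch, so G can be averaged with the
weights held fixed.

This average is computed by Gaussian integration by parts (`integral_batchCov_mul_eval`): E[G_ij f]
= δ_ij E[f] + (1/b) E[∂_ij f], where ∂_ij moves G by E_ij G + G E_ji. When G is the leftmost factor
of a product, the index j is summed, and the sum of the derivatives is again a combination of
trace-products of the same weight (`div_mem`). Each contraction thus removes one G at the cost of at
most one power of 1/b, and induction on the number of G's (`traceProduct_mem_meanSubmodule`) leaves
a polynomial in 1/b of degree at most D.

Averaging over the last batch first and then recursing (`exists_hasSgdMean`) multiplies the degree
by 3 at each step, and the powers of 1/b add up to at most (3^t - 1)D. Expanding the gap as W₂W₁ -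
W₂*W₁* makes D = d + 2d'. Random initial weights are handled last: they are independent of the
samples, so conditioning on them amounts to freezing them (`condExp_indepFun_eq`).

Combinations of trace-products are handled as elements of the span `tracePolys`. Its weights lie in
an ordered monoid, so that ℕ can measure degree while ℕ × ℕ counts weights and G's separately. -/

/-! ### Calculus of formal terms and spans of trace-products -/

section Words

variable {𝒳 𝒞 : Type} {σ : 𝒳 → ℕ × ℕ} {τ : 𝒞 → ℕ × ℕ}

/-- An assignment of matrices to symbols of sizes `σ`. -/
abbrev MatrixEnv {𝒳 : Type} (σ : 𝒳 → ℕ × ℕ) : Type :=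
  ∀ x, Matrix (Fin (σ x).1) (Fin (σ x).2) ℝ

namespace MulFactor

/-- The weight of a factor, for weights `ω` of the parameters. -/
def wt {A : Type} [AddMonoid A] (ω : 𝒳 → A) : ∀ {m n : ℕ}, MulFactor σ τ m n → A
  | _, _, .param x => ω x
  | _, _, .paramT x => ω x
  | _, _, .const _ => 0
  | _, _, .constT _ => 0

/-- The formal transpose of a factor. -/
def transpose : ∀ {m n : ℕ}, MulFactor σ τ m n → MulFactor σ τ n m
  | _, _, .param x => .paramT x
  | _, _, .paramT x => .param x
  | _, _, .const x => .constT x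
  | _, _, .constT x => .const x

theorem eval_transpose (X : MatrixEnv σ) (C : MatrixEnv τ) {m n : ℕ} (A : MulFactor σ τ m n) :
    A.transpose.eval X C = (A.eval X C).transpose := by
  cases A <;> rfl

theorem wt_transpose {A : Type} [AddMonoid A] (ω : 𝒳 → A) {m n : ℕ} (B : MulFactor σ τ m n) :
    B.transpose.wt ω = B.wt ω := by
  cases B <;> rfl

end MulFactor

namespace MulTerm

/-- The total weight of a term, for weights `ω` of the parameters. -/
def wt {A : Type} [AddMonoid A] (ω : 𝒳 → A) : ∀ {m n : ℕ}, MulTerm σ τ m n → A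
  | _, _, .one _ => 0
  | _, _, .mul B M => B.wt ω + M.wt ω

/-- Concatenation of terms. -/
def append : ∀ {m k n : ℕ}, MulTerm σ τ m k → MulTerm σ τ k n → MulTerm σ τ m n
  | _, _, _, .one _, N => N
  | _, _, _, .mul A M, N => .mul A (M.append N)

/-- The formal transpose of a term. -/
def transpose : ∀ {m n : ℕ}, MulTerm σ τ m n → MulTerm σ τ n m
  | _, _, .one n => .one n
  | _, _, .mul A M => M.transpose.append (.mul A.transpose (.one _))

/-- The term with a single factor. -/
def ofFactor {m n : ℕ} (A : MulFactor σ τ m n) : MulTerm σ τ m n := .mul A (.one n)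

theorem eval_append (X : MatrixEnv σ) (C : MatrixEnv τ) {m k n : ℕ} (M : MulTerm σ τ m k)
    (N : MulTerm σ τ k n) : (M.append N).eval X C = M.eval X C * N.eval X C := by
  induction M with
  | one => simp [append, eval]
  | mul A M ih => simp [append, eval, ih, Matrix.mul_assoc]

theorem wt_append {A : Type} [AddMonoid A] (ω : 𝒳 → A) {m k n : ℕ} (M : MulTerm σ τ m k)
    (N : MulTerm σ τ k n) : (M.append N).wt ω = M.wt ω + N.wt ω := by
  induction M with
  | one => simp [append, wt]
  | mul A M ih => simp [append, wt, ih, add_assoc]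

theorem eval_transpose (X : MatrixEnv σ) (C : MatrixEnv τ) {m n : ℕ} (M : MulTerm σ τ m n) :
    M.transpose.eval X C = (M.eval X C).transpose := by
  induction M with
  | one => simp [transpose, eval]
  | mul A M ih => simp [transpose, eval, eval_append, ih, MulFactor.eval_transpose]

theorem wt_transpose {A : Type} [AddCommMonoid A] (ω : 𝒳 → A) {m n : ℕ} (M : MulTerm σ τ m n) :
    M.transpose.wt ω = M.wt ω := by
  induction M with
  | one => simp [transpose, wt]
  | mul A M ih => simp [transpose, wt, wt_append, ih, MulFactor.wt_transpose, add_comm]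

theorem wt_one_eq_degree {m n : ℕ} (M : MulTerm σ τ m n) : M.wt (fun _ => 1) = M.degree := by
  induction M with
  | one => rfl
  | mul A M ih => cases A <;> simp [wt, degree, ih, MulFactor.wt, MulFactor.degree]

/-- The derivative of `M.eval X C` when `X` moves in the direction `X'`. -/
def deval (X X' : MatrixEnv σ) (C : MatrixEnv τ) :
    ∀ {m n : ℕ}, MulTerm σ τ m n → Matrix (Fin m) (Fin n) ℝ
  | _, _, .one _ => 0
  -- A factor is linear in the symbols, so it is differentiated by inserting the direction;
  -- constants do not move, hence the value 0.
  | _, _, .mul A M => A.eval X' (fun _ => 0) * M.eval X C + A.eval X C * M.deval X X' C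

end MulTerm

namespace TraceProduct

variable {r s : ℕ}

/-- The total weight of a trace-product, for weights `ω` of the parameters. -/
def wt {A : Type} [AddMonoid A] (ω : 𝒳 → A) (T : TraceProduct σ τ r s) : A :=
  (T.traced.map fun M => M.2.wt ω).sum + T.last.wt ω

theorem wt_one_eq_degree (T : TraceProduct σ τ r s) : T.wt (fun _ => 1) = T.degree := by
  simp [wt, degree, MulTerm.wt_one_eq_degree]

/-- The derivative of the product of the traces of the terms in a list. -/
def tracesDeval (X X' : MatrixEnv σ) (C : MatrixEnv τ) : List (Σ n : ℕ, MulTerm σ τ n n) → ℝ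
  | [] => 0
  | M :: l => (M.2.deval X X' C).trace * (l.map fun M => (M.2.eval X C).trace).prod +
      (M.2.eval X C).trace * tracesDeval X X' C l

/-- The derivative of `T.eval X C` when `X` moves in the direction `X'`. -/
def deval (X X' : MatrixEnv σ) (C : MatrixEnv τ) (T : TraceProduct σ τ r s) :
    Matrix (Fin r) (Fin s) ℝ :=
  tracesDeval X X' C T.traced • T.last.eval X C +
    (T.traced.map fun M => (M.2.eval X C).trace).prod • T.last.deval X X' C

end TraceProduct

/-- Matrices depending on a real number, on parameters of sizes `σ` and on constants of sizes
`τ`. -/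
abbrev MatrixFun (σ : 𝒳 → ℕ × ℕ) (τ : 𝒞 → ℕ × ℕ) (r s : ℕ) : Type :=
  ℝ → MatrixEnv σ → MatrixEnv τ → Matrix (Fin r) (Fin s) ℝ

/-- The span of the functions `β ^ k • T.eval X C` of `β`, `X` and `C`, for `k ≤ K` and
trace-products `T` of weight at most `D`. -/
def tracePolys {A : Type} [AddCommMonoid A] [PartialOrder A] (σ : 𝒳 → ℕ × ℕ) (τ : 𝒞 → ℕ × ℕ)
    (ω : 𝒳 → A) (K : ℕ) (D : A) (r s : ℕ) : Submodule ℝ (MatrixFun σ τ r s) :=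
  Submodule.span ℝ {f | ∃ (k : ℕ) (T : TraceProduct σ τ r s), k ≤ K ∧ T.wt ω ≤ D ∧
    f = fun β X C => β ^ k • T.eval X C}

namespace tracePolys

section

variable {A : Type} [AddCommMonoid A] [PartialOrder A]
  {ω : 𝒳 → A} {K K' : ℕ} {D D' : A} {r s n : ℕ}

theorem mono (hK : K ≤ K') (hD : D ≤ D') :
    tracePolys σ τ ω K D r s ≤ tracePolys σ τ ω K' D' r s := by
  refine Submodule.span_mono ?_
  rintro f ⟨k, T, hk, hT, rfl⟩
  exact ⟨k, T, hk.trans hK, hT.trans hD, rfl⟩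

theorem congr_mem {f g : MatrixFun σ τ r s} (hf : f ∈ tracePolys σ τ ω K D r s) (hK : K ≤ K')
    (hD : D ≤ D') (h : ∀ β X C, g β X C = f β X C) : g ∈ tracePolys σ τ ω K' D' r s := by
  obtain rfl : g = f := funext fun β => funext fun X => funext fun C => h β X C
  exact mono hK hD hf

theorem monomial_mem (k : ℕ) (T : TraceProduct σ τ r s) (hk : k ≤ K) (hT : T.wt ω ≤ D) :
    (fun β X C => β ^ k • T.eval X C) ∈ tracePolys σ τ ω K D r s :=
  Submodule.subset_span ⟨k, T, hk, hT, rfl⟩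

theorem add_mem {f g : MatrixFun σ τ r s} (hf : f ∈ tracePolys σ τ ω K D r s)
    (hg : g ∈ tracePolys σ τ ω K D r s) :
    (fun β X C => f β X C + g β X C) ∈ tracePolys σ τ ω K D r s :=
  Submodule.add_mem _ hf hg

theorem sub_mem {f g : MatrixFun σ τ r s} (hf : f ∈ tracePolys σ τ ω K D r s)
    (hg : g ∈ tracePolys σ τ ω K D r s) :
    (fun β X C => f β X C - g β X C) ∈ tracePolys σ τ ω K D r s :=
  Submodule.sub_mem _ hf hg

theorem smul_mem (a : ℝ) {f : MatrixFun σ τ r s} (hf : f ∈ tracePolys σ τ ω K D r s) :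
    (fun β X C => a • f β X C) ∈ tracePolys σ τ ω K D r s :=
  Submodule.smul_mem _ a hf

theorem zero_mem : (fun _ _ _ => 0) ∈ tracePolys σ τ ω K D r s :=
  Submodule.zero_mem _

/-- A linear map that sends all monomials to a submodule sends their span to it. -/
theorem map_mem {V : Type*} [AddCommGroup V] [Module ℝ V] (φ : MatrixFun σ τ r s → V)
    (S : Submodule ℝ V) (hadd : ∀ f g, φ (f + g) = φ f + φ g)
    (hsmul : ∀ (a : ℝ) f, φ (a • f) = a • φ f)
    (h : ∀ (k : ℕ) (T : TraceProduct σ τ r s), k ≤ K → T.wt ω ≤ D →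
      φ (fun β X C => β ^ k • T.eval X C) ∈ S)
    {f : MatrixFun σ τ r s} (hf : f ∈ tracePolys σ τ ω K D r s) : φ f ∈ S := by
  induction hf using Submodule.span_induction with
  | mem f hf =>
    obtain ⟨k, T, hk, hT, rfl⟩ := hf
    exact h k T hk hT
  | zero =>
    have := hsmul 0 0
    rw [zero_smul, zero_smul] at this
    exact this ▸ S.zero_mem
  | add f g _ _ hf hg => exact hadd f g ▸ S.add_mem hf hg
  | smul a f _ hf => exact hsmul a f ▸ S.smul_mem a hf

theorem eval_mem (T : TraceProduct σ τ r s) (hT : T.wt ω ≤ D) :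
    (fun _ X C => T.eval X C) ∈ tracePolys σ τ ω K D r s := by
  simpa using monomial_mem (ω := ω) (K := K) (D := D) 0 T (Nat.zero_le _) hT

theorem term_mem (M : MulTerm σ τ r s) :
    (fun _ X C => M.eval X C) ∈ tracePolys σ τ ω K (M.wt ω) r s := by
  simpa [TraceProduct.eval] using
    eval_mem (ω := ω) (K := K) (D := M.wt ω) ⟨[], M⟩ (by simp [TraceProduct.wt])

theorem factor_mem (B : MulFactor σ τ r s) :
    (fun _ X C => B.eval X C) ∈ tracePolys σ τ ω K (B.wt ω) r s := by
  simpa [MulTerm.ofFactor, MulTerm.eval, MulTerm.wt] using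
    term_mem (ω := ω) (K := K) (MulTerm.ofFactor B)

theorem one_mem : (fun _ _ _ => 1) ∈ tracePolys σ τ ω K 0 r r :=
  term_mem (MulTerm.one r)

theorem beta_smul_mem {f : MatrixFun σ τ r s} (hf : f ∈ tracePolys σ τ ω K D r s) :
    (fun β X C => β • f β X C) ∈ tracePolys σ τ ω (K + 1) D r s := by
  refine map_mem (ω := ω) (K := K) (D := D) (fun f β X C => β • f β X C) _ (fun f g => ?_)
    (fun a f => ?_) (fun k T hk hT => ?_) hf
  · funext β X C; exact smul_add _ _ _
  · funext β X C; exact smul_comm β a (f β X C)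
  · simpa [smul_smul, ← pow_succ'] using
      monomial_mem (ω := ω) (k + 1) T (Nat.succ_le_succ hk) hT

theorem pow_smul_mem (k : ℕ) {f : MatrixFun σ τ r s} (hf : f ∈ tracePolys σ τ ω K D r s) :
    (fun β X C => β ^ k • f β X C) ∈ tracePolys σ τ ω (K + k) D r s := by
  induction k with
  | zero => simpa using hf
  | succ k ih =>
    exact congr_mem (beta_smul_mem ih) le_rfl le_rfl fun β X C => by rw [smul_smul, pow_succ']

theorem transpose_mem {f : MatrixFun σ τ r s} (hf : f ∈ tracePolys σ τ ω K D r s) :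
    (fun β X C => (f β X C).transpose) ∈ tracePolys σ τ ω K D s r := by
  refine map_mem (ω := ω) (K := K) (D := D) (fun f β X C => (f β X C).transpose) _
    (fun f g => rfl) (fun a f => rfl) (fun k T hk hT => ?_) hf
  have := monomial_mem (ω := ω) (K := K) (D := D) k ⟨T.traced, T.last.transpose⟩ hk
      (by simpa [TraceProduct.wt, MulTerm.wt_transpose] using hT)
  simpa only [TraceProduct.eval, MulTerm.eval_transpose, Matrix.transpose_smul] using this

end

section

variable {A : Type} [AddCommMonoid A] [PartialOrder A] [IsOrderedAddMonoid A]
  {ω : 𝒳 → A} {K K' : ℕ} {D D' : A} {r s n : ℕ}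

/-- Traces are scalars: the traced lists are joined, the last terms concatenated, and weights and
powers of β add. -/
theorem mul_mem {f : MatrixFun σ τ r n} {g : MatrixFun σ τ n s}
    (hf : f ∈ tracePolys σ τ ω K D r n) (hg : g ∈ tracePolys σ τ ω K' D' n s) :
    (fun β X C => f β X C * g β X C) ∈ tracePolys σ τ ω (K + K') (D + D') r s := by
  refine map_mem (ω := ω) (K := K) (D := D) (fun f β X C => f β X C * g β X C) _
    (fun f g => ?_) (fun a f => ?_) (fun k T hk hT => ?_) hf
  · funext β X C; exact Matrix.add_mul _ _ _
  · funext β X C; exact Matrix.smul_mul a (f β X C) (g β X C)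
  refine map_mem (ω := ω) (K := K') (D := D') (fun g β X C => (β ^ k • T.eval X C) * g β X C) _
    (fun f g => ?_) (fun a f => ?_) (fun k' T' hk' hT' => ?_) hg
  · funext β X C; exact Matrix.mul_add _ _ _
  · funext β X C; exact Matrix.mul_smul (β ^ k • T.eval X C) a (f β X C)
  have := monomial_mem (ω := ω) (K := K + K') (D := D + D') (k + k')
    ⟨T.traced ++ T'.traced, T.last.append T'.last⟩ (Nat.add_le_add hk hk')
    (by simpa [TraceProduct.wt, MulTerm.wt_append, add_add_add_comm] using add_le_add hT hT')
  convert this using 1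
  funext β X C
  simp only [TraceProduct.eval, MulTerm.eval_append, smul_smul, pow_add, Matrix.smul_mul,
    Matrix.mul_smul, List.map_append, List.prod_append]
  congr 1; ring

/-- Under the trace, the last term of the first factor becomes one more traced term. -/
theorem trace_smul_mem {f : MatrixFun σ τ n n} {g : MatrixFun σ τ r s}
    (hf : f ∈ tracePolys σ τ ω K D n n) (hg : g ∈ tracePolys σ τ ω K' D' r s) :
    (fun β X C => (f β X C).trace • g β X C) ∈ tracePolys σ τ ω (K + K') (D + D') r s := by
  refine map_mem (ω := ω) (K := K) (D := D) (fun f β X C => (f β X C).trace • g β X C) _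
    (fun f f' => ?_) (fun a f => ?_) (fun k T hk hT => ?_) hf
  · funext β X C; simp [add_smul]
  · funext β X C; simp [smul_smul]
  refine map_mem (ω := ω) (K := K') (D := D')
    (fun g β X C => (β ^ k • T.eval X C).trace • g β X C) _
    (fun f g => ?_) (fun a f => ?_) (fun k' T' hk' hT' => ?_) hg
  · funext β X C; exact smul_add _ _ _
  · funext β X C; exact smul_comm (β ^ k • T.eval X C).trace a (f β X C)
  have := monomial_mem (ω := ω) (K := K + K') (D := D + D') (k + k')
    ⟨T.traced ++ ⟨n, T.last⟩ :: T'.traced, T'.last⟩ (Nat.add_le_add hk hk')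
    (by
      have := add_le_add hT hT'
      simp only [TraceProduct.wt, List.map_append, List.map_cons, List.sum_append,
        List.sum_cons] at this ⊢
      simpa only [add_assoc] using this)
  convert this using 1
  funext β X C
  simp only [TraceProduct.eval, smul_smul, pow_add, Matrix.trace_smul, List.map_append,
    List.prod_append, List.map_cons, List.prod_cons, smul_eq_mul]
  congr 1; ring

end

end tracePolys

end Words

/-! ### Substitution of combinations for parameters -/

section Substitution

variable {𝒳 𝒳' 𝒞 : Type} {σ : 𝒳 → ℕ × ℕ} {σ' : 𝒳' → ℕ × ℕ} {τ : 𝒞 → ℕ × ℕ}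
  {A : Type} [AddCommMonoid A] [PartialOrder A] [IsOrderedAddMonoid A]
  {ω : 𝒳 → A} {ω' : 𝒳' → A} {r s : ℕ}

namespace tracePolys

omit [IsOrderedAddMonoid A] in
theorem subst_factor (φ : ∀ x, MatrixFun σ' τ (σ x).1 (σ x).2)
    (hφ : ∀ x, φ x ∈ tracePolys σ' τ ω' 0 (ω x) (σ x).1 (σ x).2) (B : MulFactor σ τ r s) :
    (fun β X C => B.eval (fun x => φ x β X C) C) ∈ tracePolys σ' τ ω' 0 (B.wt ω) r s := by
  cases B with
  | param x => exact hφ x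
  | paramT x => exact transpose_mem (hφ x)
  | const c => exact factor_mem (.const c)
  | constT c => exact factor_mem (.constT c)

/-- Substituting combinations of trace-products for the parameters of a term. -/
theorem subst_term (φ : ∀ x, MatrixFun σ' τ (σ x).1 (σ x).2)
    (hφ : ∀ x, φ x ∈ tracePolys σ' τ ω' 0 (ω x) (σ x).1 (σ x).2) (M : MulTerm σ τ r s) :
    (fun β X C => M.eval (fun x => φ x β X C) C) ∈ tracePolys σ' τ ω' 0 (M.wt ω) r s := by
  induction M with
  | one => exact one_mem
  | mul B M ih =>
    exact congr_mem (mul_mem (subst_factor φ hφ B) ih) le_rfl le_rfl fun _ _ _ => by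
      rw [MulTerm.eval]

/-- Substituting combinations of trace-products for the parameters of a trace-product. -/
theorem subst (φ : ∀ x, MatrixFun σ' τ (σ x).1 (σ x).2)
    (hφ : ∀ x, φ x ∈ tracePolys σ' τ ω' 0 (ω x) (σ x).1 (σ x).2) (T : TraceProduct σ τ r s) :
    (fun β X C => T.eval (fun x => φ x β X C) C) ∈ tracePolys σ' τ ω' 0 (T.wt ω) r s := by
  obtain ⟨l, M⟩ := T
  induction l with
  | nil =>
    exact congr_mem (subst_term φ hφ M) le_rfl (by simp [TraceProduct.wt]) fun _ _ _ => by
      simp [TraceProduct.eval]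
  | cons N l ih =>
    exact congr_mem (trace_smul_mem (subst_term φ hφ N.2) ih) le_rfl
      (by simp [TraceProduct.wt, add_assoc]) fun _ _ _ => by simp [TraceProduct.eval, mul_smul]

end tracePolys

end Substitution

/-! ### Derivatives in the adjoined parameter and their contraction -/

section Extension

variable {𝒳 𝒞 : Type}

/-- The sizes of the symbols when a `p × p` parameter `none` is adjoined. -/
def extSize (p : ℕ) (σ : 𝒳 → ℕ × ℕ) : Option 𝒳 → ℕ × ℕ
  | none => (p, p)
  | some x => σ x

variable {p : ℕ} {σ : 𝒳 → ℕ × ℕ} {τ : 𝒞 → ℕ × ℕ}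

/-- The values of the symbols when a `p × p` parameter `none` is adjoined. -/
def extEnv (G : Matrix (Fin p) (Fin p) ℝ) (X : MatrixEnv σ) : MatrixEnv (extSize p σ)
  | none => G
  | some x => X x

/-- The matrix `E G + G Eᵀ`, for the matrix unit `E` at `(i, j)`. -/
def unitAction (G : Matrix (Fin p) (Fin p) ℝ) (i j : Fin p) : Matrix (Fin p) (Fin p) ℝ :=
  Matrix.single i j 1 * G + G * Matrix.single j i 1

theorem transpose_unitAction (G : Matrix (Fin p) (Fin p) ℝ) (i j : Fin p) :
    (unitAction G i j).transpose = unitAction G.transpose i j := by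
  simp [unitAction, Matrix.transpose_mul, add_comm]

/-- The direction that moves the adjoined parameter `G` by `E G + G Eᵀ`, for the matrix unit `E`
at `(i, j)`, and fixes the other parameters. -/
def covDir (X : MatrixEnv (extSize p σ)) (i j : Fin p) : MatrixEnv (extSize p σ) :=
  extEnv (unitAction (X none) i j) (fun _ => 0)

/-- The direction G ↦ EG + GEᵀ commutes with transposition, so G and Gᵀ are treated alike. The
heterogeneous equality lets a caller replace m and n by p before identifying the factor. -/
theorem eval_covDir {m n : ℕ} (B : MulFactor (extSize p σ) τ m n) :
    (∀ X i j, B.eval (covDir X i j) (fun _ => 0) = 0) ∨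
    ∃ B' : MulFactor (extSize p σ) τ p p, p = m ∧ p = n ∧ HEq B B' ∧
      ∀ X C i j, B'.eval (covDir X i j) (fun _ => 0) = unitAction (B'.eval X C) i j := by
  cases B with
  | param x =>
    cases x with
    | none => exact Or.inr ⟨.param none, rfl, rfl, HEq.rfl, fun X C i j => rfl⟩
    | some x => exact Or.inl fun X i j => rfl
  | paramT x =>
    cases x with
    | none => exact Or.inr ⟨.paramT none, rfl, rfl, HEq.rfl, fun X C i j =>
        transpose_unitAction (X none) i j⟩
    | some x => exact Or.inl fun X i j => rfl
  | const c | constT c => exact Or.inl fun X i j => rfl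

theorem mul_single_one_mul_apply {m n : ℕ} (P : Matrix (Fin m) (Fin p) ℝ)
    (Q : Matrix (Fin p) (Fin n) ℝ) (i j : Fin p) (r : Fin m) (c : Fin n) :
    (P * Matrix.single i j (1 : ℝ) * Q) r c = P r i * Q j c := by
  rw [Matrix.mul_apply, Finset.sum_eq_single j]
  · simp
  · intro k _ hk
    simp [Matrix.mul_single_apply_of_ne _ _ _ _ _ hk]
  · simp

/-- A matrix unit cuts a product into an outer product. In the first summand the index j joins Y and
BZ through Yᵀ; in the second it closes YB into a trace. The factor B survives in both, so no weight
is gained or lost. -/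
theorem sum_contract {n : ℕ} (Y B : Matrix (Fin p) (Fin p) ℝ) (Z : Matrix (Fin p) (Fin n) ℝ) :
    (Matrix.of fun i c => ∑ j, (Y * unitAction B i j * Z) j c : Matrix (Fin p) (Fin n) ℝ) =
      Y.transpose * B * Z + (Y * B).trace • Z := by
  ext i c
  simp only [unitAction, Matrix.of_apply, Matrix.mul_add, Matrix.add_mul, Matrix.add_apply,
    Finset.sum_add_distrib, Matrix.smul_apply, smul_eq_mul]
  congr 1
  · rw [Matrix.mul_assoc, Matrix.mul_apply]
    refine Finset.sum_congr rfl fun j _ => ?_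
    rw [← Matrix.mul_assoc, Matrix.mul_assoc _ B, mul_single_one_mul_apply, Matrix.transpose_apply]
  · rw [Matrix.trace, Finset.sum_mul]
    refine Finset.sum_congr rfl fun j _ => ?_
    rw [← Matrix.mul_assoc, mul_single_one_mul_apply, Matrix.diag_apply]

/-- Cutting a cyclic word at a matrix unit opens it into an ordinary word, read backwards in the
first summand and forwards in the second. -/
theorem trace_contract {n : ℕ} (Y : Matrix (Fin n) (Fin p) ℝ) (B : Matrix (Fin p) (Fin p) ℝ)
    (Z : Matrix (Fin p) (Fin n) ℝ) :
    (Matrix.of fun i j => (Y * unitAction B i j * Z).trace : Matrix (Fin p) (Fin p) ℝ) =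
      (B * Z * Y).transpose + Z * Y * B := by
  ext i j
  simp only [unitAction, Matrix.of_apply, Matrix.mul_add, Matrix.add_mul, Matrix.add_apply,
    Matrix.trace_add]
  congr 1
  · rw [Matrix.transpose_apply, Matrix.mul_apply]
    refine Finset.sum_congr rfl fun j _ => ?_
    rw [Matrix.diag_apply, ← Matrix.mul_assoc, Matrix.mul_assoc _ B, mul_single_one_mul_apply,
      mul_comm]
  · rw [Matrix.mul_assoc Z, Matrix.mul_apply, Matrix.trace]
    refine Finset.sum_congr rfl fun j _ => ?_
    rw [Matrix.diag_apply, ← Matrix.mul_assoc, mul_single_one_mul_apply, mul_comm]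

namespace tracePolys

variable {A : Type} [AddCommMonoid A] [PartialOrder A] [IsOrderedAddMonoid A]
  {ω : Option 𝒳 → A} {K K' : ℕ} {D D' : A} {m n r : ℕ}

theorem div_factor {f : MatrixFun (extSize p σ) τ p m} {g : MatrixFun (extSize p σ) τ n r}
    (B : MulFactor (extSize p σ) τ m n)
    (hf : f ∈ tracePolys (extSize p σ) τ ω K D p m)
    (hg : g ∈ tracePolys (extSize p σ) τ ω K' D' n r) :
    (fun β X C => Matrix.of fun i c =>
      ∑ j, (f β X C * B.eval (covDir X i j) (fun _ => 0) * g β X C) j c) ∈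
      tracePolys (extSize p σ) τ ω (K + K') (D + B.wt ω + D') p r := by
  obtain h | ⟨B', rfl, rfl, hB, h⟩ := eval_covDir B
  · exact congr_mem zero_mem le_rfl le_rfl fun β X C => by ext; simp [h]
  obtain rfl := eq_of_heq hB
  have hB := factor_mem (ω := ω) (K := 0) B
  refine congr_mem (add_mem (mul_mem (mul_mem (transpose_mem hf) hB) hg)
    (trace_smul_mem (mul_mem hf hB) hg)) le_rfl le_rfl fun β X C => ?_
  rw [← sum_contract]
  simp only [h X C]

/-- By the product rule each factor is hit in turn; f collects the prefix already passed, which is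
why D varies in the induction. -/
theorem div_term {f : MatrixFun (extSize p σ) τ p m}
    (M : MulTerm (extSize p σ) τ m n)
    (hf : f ∈ tracePolys (extSize p σ) τ ω K D p m) :
    (fun β X C => Matrix.of fun i c => ∑ j, (f β X C * M.deval X (covDir X i j) C) j c) ∈
      tracePolys (extSize p σ) τ ω K (D + M.wt ω) p n := by
  induction M generalizing D with
  | one =>
    exact congr_mem zero_mem le_rfl le_rfl fun β X C => by ext; simp [MulTerm.deval]
  | mul B M ih =>
    have h1 := div_factor B hf (term_mem (ω := ω) (K := 0) M)
    have hB := mul_mem hf (factor_mem (ω := ω) (K := 0) B)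
    rw [add_zero] at hB
    have h2 := ih hB
    rw [add_assoc] at h1 h2
    refine congr_mem (add_mem h1 h2) le_rfl le_rfl fun β X C => ?_
    ext i c
    simp [MulTerm.deval, Matrix.mul_add, Finset.sum_add_distrib, Matrix.mul_assoc]

theorem grad_factor {f : MatrixFun (extSize p σ) τ r m} {g : MatrixFun (extSize p σ) τ n r}
    (B : MulFactor (extSize p σ) τ m n)
    (hf : f ∈ tracePolys (extSize p σ) τ ω K D r m)
    (hg : g ∈ tracePolys (extSize p σ) τ ω K' D' n r) :
    (fun β X C => Matrix.of fun i j =>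
      (f β X C * B.eval (covDir X i j) (fun _ => 0) * g β X C).trace) ∈
      tracePolys (extSize p σ) τ ω (K + K') (D + B.wt ω + D') p p := by
  obtain h | ⟨B', rfl, rfl, hB, h⟩ := eval_covDir B
  · exact congr_mem zero_mem le_rfl le_rfl fun β X C => by ext; simp [h]
  obtain rfl := eq_of_heq hB
  have hB := factor_mem (ω := ω) (K := 0) B
  refine congr_mem (add_mem (mono (Nat.le_of_eq ?_) (le_of_eq ?_)
      (transpose_mem (mul_mem (mul_mem hB hg) hf)))
    (mono (Nat.le_of_eq ?_) (le_of_eq ?_) (mul_mem (mul_mem hg hf) hB)))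
    (le_refl (K + K')) (le_refl (D + B.wt ω + D')) fun β X C => ?_
  · ring
  · abel
  · ring
  · abel
  rw [← trace_contract]
  simp only [h X C]

theorem grad_term {f : MatrixFun (extSize p σ) τ n m}
    (M : MulTerm (extSize p σ) τ m n)
    (hf : f ∈ tracePolys (extSize p σ) τ ω K D n m) :
    (fun β X C => Matrix.of fun i j => (f β X C * M.deval X (covDir X i j) C).trace) ∈
      tracePolys (extSize p σ) τ ω K (D + M.wt ω) p p := by
  induction M generalizing D with
  | one =>
    exact congr_mem zero_mem le_rfl le_rfl fun β X C => by ext; simp [MulTerm.deval]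
  | mul B M ih =>
    have h1 := grad_factor B hf (term_mem (ω := ω) (K := 0) M)
    have hB := mul_mem hf (factor_mem (ω := ω) (K := 0) B)
    rw [add_zero] at hB
    have h2 := ih hB
    rw [add_assoc] at h1 h2
    refine congr_mem (add_mem h1 h2) le_rfl le_rfl fun β X C => ?_
    ext i j
    simp [MulTerm.deval, Matrix.mul_add, Matrix.mul_assoc]

theorem traces_smul_mem (l : List (Σ n : ℕ, MulTerm σ τ n n)) {ω : 𝒳 → A}
    {g : MatrixFun σ τ r n} (hg : g ∈ tracePolys σ τ ω K D r n) :
    (fun β X C => (l.map fun M => (M.2.eval X C).trace).prod • g β X C) ∈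
      tracePolys σ τ ω K ((l.map fun M => M.2.wt ω).sum + D) r n := by
  induction l with
  | nil => simpa using hg
  | cons M l ih =>
    exact congr_mem (trace_smul_mem (term_mem (ω := ω) (K := 0) M.2) ih) (by simp)
      (by simp [add_assoc]) fun β X C => by simp [mul_smul]

theorem grad_traces (l : List (Σ n : ℕ, MulTerm (extSize p σ) τ n n)) :
    (fun _ X C => Matrix.of fun i j => TraceProduct.tracesDeval X (covDir X i j) C l) ∈
      tracePolys (extSize p σ) τ ω 0 (l.map fun M => M.2.wt ω).sum p p := by
  induction l with
  | nil =>
    exact congr_mem zero_mem le_rfl le_rfl fun β X C => by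
      ext; simp [TraceProduct.tracesDeval]
  | cons M l ih =>
    have h1 := traces_smul_mem l (grad_term M.2 (one_mem (τ := τ) (ω := ω) (K := 0)))
    have h2 := trace_smul_mem (term_mem (ω := ω) (K := 0) M.2) ih
    rw [zero_add, add_comm] at h1
    refine congr_mem (add_mem h1 h2) le_rfl (by simp) fun β X C => ?_
    ext i j
    simp [TraceProduct.tracesDeval, mul_comm]

/-- The divergence of a trace-product is a combination of trace-products of the same weight. -/
theorem div_mem (T : TraceProduct (extSize p σ) τ p n) :
    (fun _ X C => Matrix.of fun i c => ∑ j, T.deval X (covDir X i j) C j c) ∈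
      tracePolys (extSize p σ) τ ω 0 (T.wt ω) p n := by
  -- Product rule: a derivative that hits the traces gives a p × p gradient matrix, and summing over
  -- j multiplies it with the last term.
  have h1 := mul_mem (grad_traces T.traced) (term_mem (ω := ω) (K := 0) T.last)
  have h2 := traces_smul_mem T.traced (div_term T.last (one_mem (τ := τ) (ω := ω) (K := 0)))
  simp only [zero_add, Matrix.one_mul] at h2
  refine congr_mem (add_mem h1 h2) le_rfl le_rfl fun β X C => ?_
  ext i c
  simp only [TraceProduct.deval, Finset.sum_add_distrib, Matrix.mul_apply, Finset.mul_sum,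
    Matrix.add_apply, Matrix.smul_apply, Matrix.of_apply, smul_eq_mul]

end tracePolys

end Extension

/-! ### Gaussian integration by parts for polynomials -/

section GaussianMoments

theorem hasDerivAt_gaussianPDFReal_zero_one (x : ℝ) :
    HasDerivAt (gaussianPDFReal 0 1) (-x * gaussianPDFReal 0 1 x) x := by
  have e : gaussianPDFReal 0 1 = fun y => (√(2 * Real.pi))⁻¹ * Real.exp (-y ^ 2 / 2) := by
    ext y; simp [gaussianPDFReal]
  have h : HasDerivAt (fun x : ℝ => -x ^ 2 / 2) (-x) x :=
    (((hasDerivAt_pow 2 x).neg).div_const 2).congr_deriv (by simp; ring)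
  rw [e]
  exact ((h.exp).const_mul (√(2 * Real.pi))⁻¹).congr_deriv (by ring)

theorem integrable_pow_mul_gaussianPDFReal (n : ℕ) :
    Integrable (fun x : ℝ => x ^ n * gaussianPDFReal 0 1 x) := by
  have := (integrable_rpow_mul_exp_neg_mul_sq (b := 1 / 2) (by norm_num) (s := n)
    (lt_of_lt_of_le (by norm_num) n.cast_nonneg)).const_mul (√(2 * Real.pi))⁻¹
  refine this.congr (Filter.Eventually.of_forall fun x => ?_)
  simp [gaussianPDFReal]
  ring_nf

theorem integrable_pow_gaussianReal (n : ℕ) :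
    Integrable (fun x : ℝ => x ^ n) (gaussianReal 0 1) := by
  rw [gaussianReal_of_var_ne_zero _ one_ne_zero, integrable_withDensity_iff_integrable_smul']
  · refine (integrable_pow_mul_gaussianPDFReal n).congr (Filter.Eventually.of_forall fun x => ?_)
    simp [mul_comm]
  · exact measurable_gaussianPDF _ _
  · exact Filter.Eventually.of_forall fun x => gaussianPDF_lt_top

/-- Integration by parts of x ^ n against the density φ, with φ' = -xφ. For n = 0 the truncated
exponent is harmless, as the coefficient n vanishes. -/
theorem integral_pow_succ_gaussianReal (n : ℕ) :
    ∫ x, x ^ (n + 1) ∂(gaussianReal 0 1) = n * ∫ x, x ^ (n - 1) ∂(gaussianReal 0 1) := by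
  have h := integral_mul_deriv_eq_deriv_mul_of_integrable
    (u := fun x : ℝ => x ^ n) (u' := fun x : ℝ => n * x ^ (n - 1))
    (v := gaussianPDFReal 0 1) (v' := fun x => -x * gaussianPDFReal 0 1 x)
    (fun x _ => hasDerivAt_pow n x) (fun x _ => hasDerivAt_gaussianPDFReal_zero_one x) ?_ ?_
    (integrable_pow_mul_gaussianPDFReal n)
  · rw [integral_gaussianReal_eq_integral_smul one_ne_zero,
      integral_gaussianReal_eq_integral_smul one_ne_zero, ← integral_const_mul]
    rw [← neg_eq_iff_eq_neg, ← integral_neg] at h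
    convert h using 1
    · refine integral_congr_ae (Filter.Eventually.of_forall fun x => ?_)
      simp; ring
    · refine integral_congr_ae (Filter.Eventually.of_forall fun x => ?_)
      simp; ring
  · refine (integrable_pow_mul_gaussianPDFReal (n + 1)).neg.congr
      (Filter.Eventually.of_forall fun x => ?_)
    simp; ring
  · refine ((integrable_pow_mul_gaussianPDFReal (n - 1)).const_mul n).congr
      (Filter.Eventually.of_forall fun x => ?_)
    simp; ring

variable {ι : Type} [Fintype ι]

/-- The standard Gaussian measure on `ι → ℝ`. -/
noncomputable abbrev stdGaussianPi (ι : Type) [Fintype ι] : Measure (ι → ℝ) :=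
  Measure.pi fun _ => gaussianReal 0 1

theorem integrable_eval_stdGaussianPi (P : MvPolynomial ι ℝ) :
    Integrable (fun z => MvPolynomial.eval z P) (stdGaussianPi ι) := by
  induction P using MvPolynomial.induction_on' with
  | monomial s a =>
    simp only [MvPolynomial.eval_monomial]
    refine Integrable.const_mul ?_ a
    simp only [Finsupp.prod_fintype _ _ (fun _ => pow_zero _)]
    exact Integrable.fintype_prod fun i => integrable_pow_gaussianReal (s i)
  | add P Q hP hQ => exact (hP.add hQ).congr (Filter.Eventually.of_forall fun z => by simp)

theorem integral_eval_monomial_stdGaussianPi (s : ι →₀ ℕ) (a : ℝ) :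
    ∫ z, MvPolynomial.eval z (MvPolynomial.monomial s a) ∂(stdGaussianPi ι) =
      a * ∏ i, ∫ x, x ^ s i ∂(gaussianReal 0 1) := by
  simp only [MvPolynomial.eval_monomial]
  rw [integral_const_mul]
  congr 1
  simp only [Finsupp.prod_fintype _ _ (fun _ => pow_zero _)]
  exact integral_fintype_prod_eq_prod (fun i (x : ℝ) => x ^ s i)

/-- Gaussian integration by parts for polynomials. -/
theorem integral_mul_eval_stdGaussianPi (k : ι) (P : MvPolynomial ι ℝ) :
    ∫ z, z k * MvPolynomial.eval z P ∂(stdGaussianPi ι) =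
      ∫ z, MvPolynomial.eval z (MvPolynomial.pderiv k P) ∂(stdGaussianPi ι) := by
  classical
  have hX : ∀ (P : MvPolynomial ι ℝ) z, z k * MvPolynomial.eval z P =
    MvPolynomial.eval z (MvPolynomial.X k * P) := by simp
  simp only [hX]
  induction P using MvPolynomial.induction_on' with
  | monomial s a =>
    have : MvPolynomial.X k * MvPolynomial.monomial s a =
        MvPolynomial.monomial (s + Finsupp.single k 1) a := by
      rw [MvPolynomial.monomial_add_single, pow_one, mul_comm]
    rw [this, MvPolynomial.pderiv_monomial, integral_eval_monomial_stdGaussianPi,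
      integral_eval_monomial_stdGaussianPi, ← Finset.mul_prod_erase _ _ (Finset.mem_univ k),
      ← Finset.mul_prod_erase _ _ (Finset.mem_univ k)]
    -- Moments of a monomial factor over coordinates, and only coordinate k differs between the two
    -- sides; there the one-dimensional recursion applies.
    have h1 : ∀ i ∈ Finset.univ.erase k,
        ∫ x, x ^ ((s + Finsupp.single k 1 : ι →₀ ℕ) i) ∂(gaussianReal 0 1) =
        ∫ x, x ^ ((s - Finsupp.single k 1 : ι →₀ ℕ) i) ∂(gaussianReal 0 1) := by
      intro i hi
      have : Finsupp.single k 1 i = 0 := Finsupp.single_eq_of_ne (Finset.ne_of_mem_erase hi)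
      simp [this]
    rw [Finset.prod_congr rfl h1]
    have h2 := integral_pow_succ_gaussianReal (s k)
    simp only [Finsupp.add_apply, Finsupp.tsub_apply, Finsupp.single_eq_same, h2]
    ring
  | add P Q hP hQ =>
    simp only [mul_add, map_add]
    rw [integral_add (integrable_eval_stdGaussianPi _) (integrable_eval_stdGaussianPi _),
      integral_add (integrable_eval_stdGaussianPi _) (integrable_eval_stdGaussianPi _), hP, hQ]

end GaussianMoments

/-! ### Formal derivatives realised by derivations of polynomials -/

section PolynomialPairs

variable {ι : Type}

/-- `f` is a polynomial function, and `f'` is its image under the derivation `δ`. -/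
def IsDerivPair (δ : Derivation ℝ (MvPolynomial ι ℝ) (MvPolynomial ι ℝ)) (f f' : (ι → ℝ) → ℝ) :
    Prop :=
  ∃ P, (∀ z, f z = MvPolynomial.eval z P) ∧ ∀ z, f' z = MvPolynomial.eval z (δ P)

namespace IsDerivPair

variable {δ : Derivation ℝ (MvPolynomial ι ℝ) (MvPolynomial ι ℝ)} {f f' g g' : (ι → ℝ) → ℝ}

theorem const (a : ℝ) : IsDerivPair δ (fun _ => a) (fun _ => 0) :=
  ⟨MvPolynomial.C a, by simp, by simp [← MvPolynomial.algebraMap_eq]⟩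

theorem mul (hf : IsDerivPair δ f f') (hg : IsDerivPair δ g g') :
    IsDerivPair δ (fun z => f z * g z) (fun z => f' z * g z + f z * g' z) := by
  obtain ⟨P, h1, h2⟩ := hf
  obtain ⟨Q, h3, h4⟩ := hg
  exact ⟨P * Q, by simp [h1, h3], fun z => by simp [h1, h2, h3, h4]; ring⟩

theorem sum {κ : Type*} (s : Finset κ) {f f' : κ → (ι → ℝ) → ℝ}
    (h : ∀ k, IsDerivPair δ (f k) (f' k)) :
    IsDerivPair δ (fun z => ∑ k ∈ s, f k z) (fun z => ∑ k ∈ s, f' k z) := by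
  choose P h1 h2 using h
  exact ⟨∑ k ∈ s, P k, by simp [h1], by simp [h2]⟩

theorem matrix_mul {m n r : ℕ} {F F' : (ι → ℝ) → Matrix (Fin m) (Fin n) ℝ}
    {H H' : (ι → ℝ) → Matrix (Fin n) (Fin r) ℝ}
    (hF : ∀ i j, IsDerivPair δ (fun z => F z i j) (fun z => F' z i j))
    (hH : ∀ i j, IsDerivPair δ (fun z => H z i j) (fun z => H' z i j)) (i : Fin m) (j : Fin r) :
    IsDerivPair δ (fun z => (F z * H z) i j) (fun z => (F' z * H z + F z * H' z) i j) := by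
  simpa only [Matrix.mul_apply, Matrix.add_apply, ← Finset.sum_add_distrib] using
    sum Finset.univ fun k => (hF i k).mul (hH k j)

variable {𝒳 𝒞 : Type} {σ : 𝒳 → ℕ × ℕ} {τ : 𝒞 → ℕ × ℕ} {r s : ℕ}
  {X X' : (ι → ℝ) → MatrixEnv σ}

theorem factor_eval (hX : ∀ x i j, IsDerivPair δ (fun z => X z x i j) (fun z => X' z x i j))
    (C : MatrixEnv τ) (B : MulFactor σ τ r s) (i : Fin r) (j : Fin s) :
    IsDerivPair δ (fun z => B.eval (X z) C i j) (fun z => B.eval (X' z) (fun _ => 0) i j) := by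
  cases B with
  | param x => exact hX x i j
  | paramT x => exact hX x j i
  | const c => exact const (C c i j)
  | constT c => exact const (C c j i)

theorem term_eval (hX : ∀ x i j, IsDerivPair δ (fun z => X z x i j) (fun z => X' z x i j))
    (C : MatrixEnv τ) (M : MulTerm σ τ r s) (i : Fin r) (j : Fin s) :
    IsDerivPair δ (fun z => M.eval (X z) C i j) (fun z => M.deval (X z) (X' z) C i j) := by
  induction M with
  | one n => exact const ((1 : Matrix (Fin n) (Fin n) ℝ) i j)
  | mul B M ih => exact matrix_mul (factor_eval hX C B) ih i j

theorem trace {n : ℕ} {F F' : (ι → ℝ) → Matrix (Fin n) (Fin n) ℝ}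
    (hF : ∀ i j, IsDerivPair δ (fun z => F z i j) (fun z => F' z i j)) :
    IsDerivPair δ (fun z => (F z).trace) (fun z => (F' z).trace) :=
  sum Finset.univ fun i => hF i i

theorem traces_eval (hX : ∀ x i j, IsDerivPair δ (fun z => X z x i j) (fun z => X' z x i j))
    (C : MatrixEnv τ) (l : List (Σ n : ℕ, MulTerm σ τ n n)) :
    IsDerivPair δ (fun z => (l.map fun M => (M.2.eval (X z) C).trace).prod)
      (fun z => TraceProduct.tracesDeval (X z) (X' z) C l) := by
  induction l with
  | nil => exact const 1
  | cons M l ih =>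
    simpa only [List.map_cons, List.prod_cons, TraceProduct.tracesDeval] using
      (trace (term_eval hX C M.2)).mul ih

theorem eval (hX : ∀ x i j, IsDerivPair δ (fun z => X z x i j) (fun z => X' z x i j))
    (C : MatrixEnv τ) (T : TraceProduct σ τ r s) (i : Fin r) (j : Fin s) :
    IsDerivPair δ (fun z => T.eval (X z) C i j) (fun z => T.deval (X z) (X' z) C i j) :=
  (traces_eval hX C T.traced).mul (term_eval hX C T.last i j)

end IsDerivPair

end PolynomialPairs

/-! ### The Gaussian second moment under integration by parts -/

section Wishart

variable {b p : ℕ}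

/-- The empirical second moment `(1/b) ∑ₖ zₖ zₖᵀ` of a batch of `b` vectors. -/
noncomputable def batchCov (z : Fin b × Fin p → ℝ) : Matrix (Fin p) (Fin p) ℝ :=
  (1 / (b : ℝ)) • ∑ k, Matrix.vecMulVec (fun i => z (k, i)) (fun i => z (k, i))

theorem batchCov_apply (z : Fin b × Fin p → ℝ) (i j : Fin p) :
    batchCov z i j = (1 / (b : ℝ)) * ∑ k, z (k, i) * z (k, j) := by
  simp [batchCov, Matrix.sum_apply, Matrix.vecMulVec_apply]

/-- The derivation `∑ₖ z(k,j) ∂/∂z(k,i)`. -/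
noncomputable def rotDeriv (b : ℕ) (i j : Fin p) :
    Derivation ℝ (MvPolynomial (Fin b × Fin p) ℝ) (MvPolynomial (Fin b × Fin p) ℝ) :=
  ∑ k : Fin b, (MvPolynomial.X (k, j) : MvPolynomial (Fin b × Fin p) ℝ) • MvPolynomial.pderiv (k, i)

theorem rotDeriv_apply (i j : Fin p) (P : MvPolynomial (Fin b × Fin p) ℝ) :
    rotDeriv b i j P = ∑ k, MvPolynomial.X (k, j) * MvPolynomial.pderiv (k, i) P := by
  rw [rotDeriv, ← Derivation.coeFnAddMonoidHom_apply]
  simp [map_sum]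

theorem rotDeriv_X (i j a : Fin p) (k : Fin b) :
    rotDeriv b i j (MvPolynomial.X (k, a)) = if a = i then MvPolynomial.X (k, j) else 0 := by
  rw [rotDeriv_apply, Finset.sum_eq_single k]
  · by_cases h : a = i
    · subst h; simp
    · rw [MvPolynomial.pderiv_X_of_ne (by simpa using h)]; simp [h]
  · intro l _ hl
    rw [MvPolynomial.pderiv_X_of_ne (by simp [hl.symm]), mul_zero]
  · simp

theorem unitAction_apply (G : Matrix (Fin p) (Fin p) ℝ) (i j a c : Fin p) :
    unitAction G i j a c = (if a = i then G j c else 0) + if c = i then G a j else 0 := by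
  rw [unitAction, Matrix.add_apply]
  congr 1
  · have := mul_single_one_mul_apply 1 G i j a c
    simpa [Matrix.one_apply] using this
  · have := mul_single_one_mul_apply G 1 j i a c
    simpa [Matrix.one_apply, eq_comm] using this

/-- The derivation replaces the index i by j in each variable; by Leibniz on z(k,a) z(k,c) this acts
on G on the left and on the right. -/
theorem isDerivPair_batchCov (i j a c : Fin p) :
    IsDerivPair (rotDeriv b i j) (fun z => batchCov z a c)
      (fun z => unitAction (batchCov z) i j a c) := by
  refine ⟨MvPolynomial.C (1 / (b : ℝ)) *
    ∑ k, MvPolynomial.X (k, a) * MvPolynomial.X (k, c), fun z => ?_, fun z => ?_⟩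
  · simp [batchCov_apply]
  · have hC : rotDeriv b i j (MvPolynomial.C (1 / (b : ℝ))) = 0 :=
      Derivation.map_algebraMap _ _
    rw [Derivation.leibniz, hC]
    simp only [map_sum, Derivation.leibniz, rotDeriv_X, unitAction_apply, batchCov_apply]
    by_cases h1 : a = i <;> by_cases h2 : c = i <;>
      simp [h1, h2, Finset.sum_add_distrib, mul_add, mul_comm, add_comm]

/-- Integration by parts in z(k,i) against z(k,j) P. Differentiating z(k,j) gives δ_ij for each of
the b samples, which cancels 1/b (hence b ≥ 1); differentiating P keeps the factor 1/b. -/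
theorem integral_batchCov_mul_eval (hb : 1 ≤ b) (i j : Fin p)
    (P : MvPolynomial (Fin b × Fin p) ℝ) :
    ∫ z, batchCov z i j * MvPolynomial.eval z P ∂(stdGaussianPi (Fin b × Fin p)) =
      (if i = j then ∫ z, MvPolynomial.eval z P ∂(stdGaussianPi (Fin b × Fin p)) else 0) +
      (1 / (b : ℝ)) *
        ∫ z, MvPolynomial.eval z (rotDeriv b i j P) ∂(stdGaussianPi (Fin b × Fin p)) := by
  have hb0 : (b : ℝ) ≠ 0 := by positivity
  have h1 : ∀ z : Fin b × Fin p → ℝ, batchCov z i j * MvPolynomial.eval z P =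
      (1 / (b : ℝ)) * ∑ k, z (k, i) * MvPolynomial.eval z (MvPolynomial.X (k, j) * P) := by
    intro z
    simp [batchCov_apply, Finset.sum_mul, mul_assoc]
  have h2 : ∀ k : Fin b, ∫ z, z (k, i) * MvPolynomial.eval z (MvPolynomial.X (k, j) * P)
        ∂(stdGaussianPi (Fin b × Fin p)) =
      (if i = j then ∫ z, MvPolynomial.eval z P ∂(stdGaussianPi (Fin b × Fin p)) else 0) +
      ∫ z, MvPolynomial.eval z (MvPolynomial.X (k, j) * MvPolynomial.pderiv (k, i) P)
        ∂(stdGaussianPi (Fin b × Fin p)) := by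
    intro k
    rw [integral_mul_eval_stdGaussianPi, Derivation.leibniz, MvPolynomial.pderiv_X]
    simp only [smul_eq_mul, map_add]
    rw [integral_add (integrable_eval_stdGaussianPi _) (integrable_eval_stdGaussianPi _), add_comm]
    congr 1
    by_cases h : i = j
    · simp [h]
    · simp [h, Ne.symm h]
  simp only [h1]
  rw [integral_const_mul, integral_finsetSum, Finset.sum_congr rfl fun k _ => h2 k,
    Finset.sum_add_distrib, ← integral_finsetSum]
  · simp [rotDeriv_apply, mul_add, hb0]
  · exact fun k _ => integrable_eval_stdGaussianPi _
  · intro k _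
    exact (integrable_eval_stdGaussianPi
      (MvPolynomial.X (k, i) * (MvPolynomial.X (k, j) * P))).congr
        (Filter.Eventually.of_forall fun z => by simp)

end Wishart

/-! ### Averaging out the second moment -/

section WishartContraction

variable {𝒳 𝒞 : Type} {p : ℕ} {σ : 𝒳 → ℕ × ℕ} {τ : 𝒞 → ℕ × ℕ}

theorem batchCov_transpose {b : ℕ} (z : Fin b × Fin p → ℝ) :
    (batchCov z).transpose = batchCov z := by
  ext i j
  simp [batchCov_apply, mul_comm]

/-- The pair of weights that counts the appearances of the old parameters and of the adjoined
parameter. -/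
def extWt : Option 𝒳 → ℕ × ℕ
  | none => (0, 1)
  | some _ => (1, 0)

theorem isDerivPair_extEnv {b : ℕ} (i j : Fin p) (X : MatrixEnv σ) (x : Option 𝒳)
    (a : Fin (extSize p σ x).1) (c : Fin (extSize p σ x).2) :
    IsDerivPair (rotDeriv b i j) (fun z => extEnv (batchCov z) X x a c)
      (fun z => covDir (extEnv (batchCov z) X) i j x a c) := by
  cases x with
  | none => exact isDerivPair_batchCov i j a c
  | some x => exact IsDerivPair.const _

theorem integral_batchCov_mul_traceProduct {b r s : ℕ} (hb : 1 ≤ b) (i j : Fin p)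
    (T : TraceProduct (extSize p σ) τ r s) (X : MatrixEnv σ) (C : MatrixEnv τ) (a : Fin r)
    (c : Fin s) :
    Integrable (fun z => batchCov z i j * T.eval (extEnv (batchCov z) X) C a c)
      (stdGaussianPi (Fin b × Fin p)) ∧
    Integrable (fun z => T.deval (extEnv (batchCov z) X) (covDir (extEnv (batchCov z) X) i j) C a c)
      (stdGaussianPi (Fin b × Fin p)) ∧
    ∫ z, batchCov z i j * T.eval (extEnv (batchCov z) X) C a c ∂(stdGaussianPi (Fin b × Fin p)) =
      (if i = j then ∫ z, T.eval (extEnv (batchCov z) X) C a c ∂(stdGaussianPi (Fin b × Fin p))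
        else 0) +
      (1 / (b : ℝ)) *
        ∫ z, T.deval (extEnv (batchCov z) X) (covDir (extEnv (batchCov z) X) i j) C a c
          ∂(stdGaussianPi (Fin b × Fin p)) := by
  obtain ⟨P, hP, hP'⟩ := IsDerivPair.eval (isDerivPair_extEnv (b := b) i j X) C T a c
  obtain ⟨Q, hQ, -⟩ := isDerivPair_batchCov (b := b) i j i j
  simp only [hP, hP', integral_batchCov_mul_eval hb, and_true]
  refine ⟨?_, integrable_eval_stdGaussianPi _⟩
  exact (integrable_eval_stdGaussianPi (Q * P)).congr
    (Filter.Eventually.of_forall fun z => by simp [hQ])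

/-- The functions whose mean over the adjoined parameter, replaced by the second moment of a
batch of `b` Gaussian vectors, is a combination of trace-products in the old parameters, with
coefficients that are polynomials of degree at most `K` in `1 / b`. -/
def meanSubmodule (p : ℕ) (σ : 𝒳 → ℕ × ℕ) (τ : 𝒞 → ℕ × ℕ) (K D r s : ℕ) :
    Submodule ℝ (MatrixFun (extSize p σ) τ r s) where
  -- H is chosen before b, X and C; this yields formal terms independent of the batch size and of
  -- all weights.
  carrier := {f | ∃ H ∈ tracePolys σ τ (fun _ => 1) K D r s, ∀ b : ℕ, 1 ≤ b → ∀ X C i j,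
    Integrable (fun z => f (1 / (b : ℝ)) (extEnv (batchCov z) X) C i j)
      (stdGaussianPi (Fin b × Fin p)) ∧
    ∫ z, f (1 / (b : ℝ)) (extEnv (batchCov z) X) C i j ∂(stdGaussianPi (Fin b × Fin p)) =
      H (1 / (b : ℝ)) X C i j}
  add_mem' := by
    rintro f g ⟨H, hH, hf⟩ ⟨I, hI, hg⟩
    refine ⟨_, tracePolys.add_mem hH hI, fun b hb X C i j => ?_⟩
    refine ⟨(hf b hb X C i j).1.add (hg b hb X C i j).1, ?_⟩
    rw [Matrix.add_apply, ← (hf b hb X C i j).2, ← (hg b hb X C i j).2]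
    exact integral_add (hf b hb X C i j).1 (hg b hb X C i j).1
  zero_mem' := ⟨_, tracePolys.zero_mem, fun b hb X C i j => by simp⟩
  smul_mem' := by
    rintro a f ⟨H, hH, hf⟩
    refine ⟨_, tracePolys.smul_mem a hH, fun b hb X C i j => ?_⟩
    refine ⟨(hf b hb X C i j).1.const_mul a, ?_⟩
    rw [Matrix.smul_apply, ← (hf b hb X C i j).2]
    exact integral_const_mul a _

namespace meanSubmodule

variable {K D r s m : ℕ}

theorem congr_mem {f g : MatrixFun (extSize p σ) τ r s} (hf : f ∈ meanSubmodule p σ τ K D r s)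
    (h : ∀ (b : ℕ) (β : ℝ) (z : Fin b × Fin p → ℝ) X C,
      g β (extEnv (batchCov z) X) C = f β (extEnv (batchCov z) X) C) :
    g ∈ meanSubmodule p σ τ K D r s := by
  obtain ⟨H, hH, hf⟩ := hf
  refine ⟨H, hH, fun b hb X C i j => ?_⟩
  simpa only [h] using hf b hb X C i j

theorem factor_mul_mem {f : MatrixFun (extSize p σ) τ m s} (hf : f ∈ meanSubmodule p σ τ K D m s)
    (B : MulFactor σ τ r m) :
    (fun β X C => B.eval (fun x => X (some x)) C * f β X C) ∈
      meanSubmodule p σ τ K (B.wt (fun _ => 1) + D) r s := by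
  obtain ⟨H, hH, hf⟩ := hf
  have hB := tracePolys.factor_mem (ω := fun _ => 1) (K := 0) B
  refine ⟨_, tracePolys.congr_mem (tracePolys.mul_mem hB hH) (by simp) le_rfl fun _ _ _ => rfl,
    fun b hb X C i j => ?_⟩
  simp only [Matrix.mul_apply]
  refine ⟨integrable_finsetSum _ fun k _ => ((hf b hb X C k j).1.const_mul (B.eval X C i k)), ?_⟩
  refine (integral_finsetSum _ fun k _ => ((hf b hb X C k j).1.const_mul (B.eval X C i k))).trans ?_
  refine Finset.sum_congr rfl fun k _ => ?_
  rw [← (hf b hb X C k j).2]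
  exact integral_const_mul _ _

theorem trace_smul_one_mem {f : MatrixFun (extSize p σ) τ m m}
    (hf : f ∈ meanSubmodule p σ τ K D m m) :
    (fun β X C => (f β X C).trace • (1 : Matrix (Fin r) (Fin r) ℝ)) ∈
      meanSubmodule p σ τ K D r r := by
  obtain ⟨H, hH, hf⟩ := hf
  have hH' := tracePolys.trace_smul_mem (K' := 0) hH (tracePolys.one_mem (r := r))
  refine ⟨_, hH', fun b hb X C i j => ?_⟩
  have h : Integrable (fun z => (f (1 / (b : ℝ)) (extEnv (batchCov z) X) C).trace)
      (stdGaussianPi (Fin b × Fin p)) := integrable_finsetSum _ fun k _ => (hf b hb X C k k).1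
  have e : ∫ z, (f (1 / (b : ℝ)) (extEnv (batchCov z) X) C).trace
      ∂(stdGaussianPi (Fin b × Fin p)) = (H (1 / (b : ℝ)) X C).trace :=
    (integral_finsetSum _ fun k _ => (hf b hb X C k k).1).trans
      (Finset.sum_congr rfl fun k _ => (hf b hb X C k k).2)
  exact ⟨h.mul_const _, (integral_mul_const _ _).trans (congrArg (· * _) e)⟩

theorem one_mem : (fun _ _ _ => 1) ∈ meanSubmodule p σ τ K D r r :=
  ⟨_, tracePolys.congr_mem tracePolys.one_mem le_rfl (Nat.zero_le D) fun _ _ _ => rfl,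
    fun b hb X C i j => by simp⟩

/-- Gaussian integration by parts: the adjoined parameter as first factor is contracted. -/
theorem param_mul_mem (T : TraceProduct (extSize p σ) τ p s)
    (hT : (fun _ X C => T.eval X C) ∈ meanSubmodule p σ τ K D p s)
    (hdiv : (fun _ X C => Matrix.of fun i c => ∑ j, T.deval X (covDir X i j) C j c) ∈
      meanSubmodule p σ τ K D p s) :
    (fun _ X C => (show Matrix (Fin p) (Fin p) ℝ from X none) * T.eval X C) ∈
      meanSubmodule p σ τ (K + 1) D p s := by
  obtain ⟨H, hH, hf⟩ := hT
  obtain ⟨I, hI, hg⟩ := hdiv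
  -- The δ_ij part, summed over j, gives H with no new power of β; the divergence part carries one
  -- β, whence K + 1.
  refine ⟨_, tracePolys.add_mem (tracePolys.mono (Nat.le_succ _) le_rfl hH)
    (tracePolys.beta_smul_mem hI), fun b hb X C i c => ?_⟩
  have key := fun j => integral_batchCov_mul_traceProduct hb i j T X C j c
  have e : ∀ z : Fin b × Fin p → ℝ, ((show Matrix (Fin p) (Fin p) ℝ from
      extEnv (batchCov z) X none) * T.eval (extEnv (batchCov z) X) C) i c =
        ∑ j, batchCov z i j * T.eval (extEnv (batchCov z) X) C j c := fun z => Matrix.mul_apply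
  simp only [e]
  refine ⟨integrable_finsetSum _ fun j _ => (key j).1, ?_⟩
  rw [integral_finsetSum _ fun j _ => (key j).1, Finset.sum_congr rfl fun j _ => (key j).2.2,
    Finset.sum_add_distrib, ← Finset.mul_sum, Matrix.add_apply, Matrix.smul_apply,
    ← (hf b hb X C i c).2, ← (hg b hb X C i c).2, Finset.sum_ite_eq, if_pos (Finset.mem_univ _)]
  simp only [Matrix.of_apply]
  rw [integral_finsetSum _ fun j _ => (key j).2.1, smul_eq_mul]

end meanSubmodule

/-- G is symmetric, so its transposed symbol may be read as G itself. -/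
theorem eval_extEnv {m n : ℕ} (B : MulFactor (extSize p σ) τ m n) :
    (∃ B₀ : MulFactor σ τ m n, B.wt extWt = (B₀.wt (fun _ => 1), 0) ∧
      ∀ G X C, B.eval (extEnv G X) C = B₀.eval X C) ∨
    ∃ B' : MulFactor (extSize p σ) τ p p, p = m ∧ p = n ∧ HEq B B' ∧ B'.wt extWt = (0, 1) ∧
      ∀ G X C, G.transpose = G → B'.eval (extEnv G X) C = G := by
  cases B with
  | param x =>
    cases x with
    | none => exact Or.inr ⟨.param none, rfl, rfl, HEq.rfl, rfl, fun G X C _ => rfl⟩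
    | some x => exact Or.inl ⟨.param x, rfl, fun _ _ _ => rfl⟩
  | paramT x =>
    cases x with
    | none => exact Or.inr ⟨.paramT none, rfl, rfl, HEq.rfl, rfl, fun G X C h => h⟩
    | some x => exact Or.inl ⟨.paramT x, rfl, fun _ _ _ => rfl⟩
  | const c => exact Or.inl ⟨.const c, rfl, fun _ _ _ => rfl⟩
  | constT c => exact Or.inl ⟨.constT c, rfl, fun _ _ _ => rfl⟩

/-- The mean of a trace-product over the adjoined parameter. -/
theorem traceProduct_mem_meanSubmodule (n : ℕ) : ∀ {D r s : ℕ}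
    (T : TraceProduct (extSize p σ) τ r s), T.wt extWt ≤ (D, n) →
      (fun _ X C => T.eval X C) ∈ meanSubmodule p σ τ n D r s := by
  induction n using Nat.strong_induction_on with
  | _ n IH =>
  -- A divergence is a combination of trace-products, so the induction hypothesis is extended
  -- linearly.
  have span_mem : ∀ n' < n, ∀ (D s : ℕ) (f : MatrixFun (extSize p σ) τ p s),
      f ∈ tracePolys (extSize p σ) τ extWt 0 (D, n') p s → f ∈ meanSubmodule p σ τ n' D p s := by
    intro n' hn' D s f hf
    refine tracePolys.map_mem (fun f => f) _ (fun _ _ => rfl) (fun _ _ => rfl) ?_ hf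
    intro k T hk hT
    obtain rfl : k = 0 := by omega
    simpa using IH n' hn' T hT
  -- The last term is peeled from the left: old factors leave the integral, and a factor G is
  -- contracted, which lowers n. What remains is the case of an identity as last term.
  have inner : ∀ l : List (Σ n : ℕ, MulTerm (extSize p σ) τ n n),
      (∀ m D, TraceProduct.wt extWt ⟨l, MulTerm.one m⟩ ≤ (D, n) →
        (fun _ X C => TraceProduct.eval X C ⟨l, MulTerm.one m⟩) ∈ meanSubmodule p σ τ n D m m) →
      ∀ (r s D : ℕ) (M : MulTerm (extSize p σ) τ r s), TraceProduct.wt extWt ⟨l, M⟩ ≤ (D, n) →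
        (fun _ X C => TraceProduct.eval X C ⟨l, M⟩) ∈ meanSubmodule p σ τ n D r s := by
    intro l hl r s D M
    induction M generalizing D with
    | one m => exact hl m D
    | mul B M ih =>
      intro hT
      have hw : TraceProduct.wt extWt ⟨l, MulTerm.mul B M⟩ =
          B.wt extWt + TraceProduct.wt extWt ⟨l, M⟩ := by
        simp [TraceProduct.wt, MulTerm.wt]; abel
      rw [hw] at hT
      obtain ⟨B₀, hB, h⟩ | ⟨B', rfl, rfl, hB, hw', h⟩ := eval_extEnv B
      · rw [hB, Prod.le_def] at hT
        simp only [Prod.fst_add, Prod.snd_add, zero_add] at hT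
        have := meanSubmodule.factor_mul_mem
          (ih (D - B₀.wt (fun _ => 1)) (Prod.le_def.2 ⟨by simp; omega, hT.2⟩)) B₀
        rw [Nat.add_sub_cancel' (by omega)] at this
        refine meanSubmodule.congr_mem this fun b β z X C => ?_
        simp only [TraceProduct.eval, MulTerm.eval, h, Matrix.mul_smul]
        rfl
      · obtain rfl := eq_of_heq hB
        rw [hw', Prod.le_def] at hT
        simp only [Prod.fst_add, Prod.snd_add, zero_add] at hT
        obtain ⟨n', rfl⟩ : ∃ n', n = n' + 1 := ⟨n - 1, by omega⟩
        have hM : TraceProduct.wt extWt ⟨l, M⟩ ≤ (D, n') := Prod.le_def.2 ⟨hT.1, by simp; omega⟩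
        have := meanSubmodule.param_mul_mem ⟨l, M⟩ (IH n' (Nat.lt_succ_self _) _ hM)
          (span_mem n' (Nat.lt_succ_self _) D _ _
            (tracePolys.mono le_rfl hM (tracePolys.div_mem ⟨l, M⟩)))
        refine meanSubmodule.congr_mem this fun b β z X C => ?_
        simp only [TraceProduct.eval, MulTerm.eval, h _ _ _ (batchCov_transpose z),
          ← Matrix.mul_smul]
        rfl
  -- Once the last term is an identity, the next traced term N takes its place, since tr(N)·1 is
  -- recovered from N by taking the trace.
  have main : ∀ (l : List (Σ n : ℕ, MulTerm (extSize p σ) τ n n)) (r s D : ℕ)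
      (M : MulTerm (extSize p σ) τ r s), TraceProduct.wt extWt ⟨l, M⟩ ≤ (D, n) →
        (fun _ X C => TraceProduct.eval X C ⟨l, M⟩) ∈ meanSubmodule p σ τ n D r s := by
    intro l
    induction l with
    | nil =>
      refine inner _ fun m D _ => ?_
      exact meanSubmodule.congr_mem meanSubmodule.one_mem fun b β z X C => by
        simp [TraceProduct.eval, MulTerm.eval]
    | cons N l ih =>
      refine inner _ fun m D hD => ?_
      have : TraceProduct.wt extWt ⟨l, N.2⟩ ≤ (D, n) := by
        refine le_trans (le_of_eq ?_) hD
        simp [TraceProduct.wt, MulTerm.wt, add_comm]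
      refine meanSubmodule.congr_mem (meanSubmodule.trace_smul_one_mem (ih _ _ D N.2 this))
        fun b β z X C => ?_
      simp [TraceProduct.eval, MulTerm.eval, mul_comm]
  intro D r s T hT
  exact main T.traced r s D T.last hT

theorem tracePolys_le_meanSubmodule {n D r s : ℕ} :
    tracePolys (extSize p σ) τ extWt 0 (D, n) r s ≤ meanSubmodule p σ τ n D r s := by
  intro f hf
  refine tracePolys.map_mem (fun f => f) _ (fun _ _ => rfl) (fun _ _ => rfl) ?_ hf
  intro k T hk hT
  obtain rfl : k = 0 := by omega
  simpa using traceProduct_mem_meanSubmodule n T hT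

end WishartContraction

/-! ### One gradient step as a substitution -/

section GradientStep

variable {p p₁ p₂ : ℕ}

/-- One gradient step of size `a`, when the batch has second moment `G`. -/
noncomputable def gradientStep (a : ℝ) (v w : Weights p p₁ p₂) (G : Matrix (Fin p) (Fin p) ℝ) :
    Weights p p₁ p₂ :=
  (w.1 - a • (w.2.transpose * gap v w * G), w.2 - a • (gap v w * G * w.1.transpose))

theorem sgdWeights_succ {b : ℕ} (α : ℕ → ℝ) (v w₀ : Weights p p₁ p₂)
    (x : ℕ → Fin b → EuclideanSpace ℝ (Fin p)) (t : ℕ) :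
    sgdWeights α v w₀ x (t + 1) = gradientStep (α t) v (sgdWeights α v w₀ x t)
      (batchCov fun ki => x t ki.1 ki.2) := by
  simp only [sgdWeights, sampleGrad₁_eq, sampleGrad₂_eq, gradientStep, batchCov, Matrix.mul_smul,
    Matrix.smul_mul, Matrix.mul_sum, Matrix.sum_mul]

theorem sgdWeights_congr {b : ℕ} (α : ℕ → ℝ) (v w₀ : Weights p p₁ p₂)
    {x y : ℕ → Fin b → EuclideanSpace ℝ (Fin p)} (t : ℕ) (h : ∀ u < t, x u = y u) :
    sgdWeights α v w₀ x t = sgdWeights α v w₀ y t := by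
  induction t with
  | zero => rfl
  | succ t ih =>
    rw [sgdWeights_succ, sgdWeights_succ, ih fun u hu => h u (hu.trans (Nat.lt_succ_self t)),
      h t (Nat.lt_succ_self t)]

/-- The layers after a gradient step as combinations of trace-products. -/
noncomputable def stepFun (p p₁ p₂ : ℕ) (a : ℝ) : ∀ l, MatrixFun (extSize p (layerSize p p₁ p₂))
    (layerSize p p₁ p₂) (layerSize p p₁ p₂ l).1 (layerSize p p₁ p₂ l).2
  | .one => fun _ X C => (gradientStep a (C .one, C .two) (X (some .one), X (some .two)) (X none)).1
  | .two => fun _ X C => (gradientStep a (C .one, C .two) (X (some .one), X (some .two)) (X none)).2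

theorem layerValue_gradientStep (a β : ℝ) (v w : Weights p p₁ p₂) (G : Matrix (Fin p) (Fin p) ℝ)
    (l : Layer) : layerValue (gradientStep a v w G) l =
      stepFun p p₁ p₂ a l β (extEnv G (layerValue w)) (layerValue v) := by
  cases l <;> rfl

theorem TraceProduct.wt_const {𝒳 𝒞 A : Type} [AddCommMonoid A] {σ : 𝒳 → ℕ × ℕ} {τ : 𝒞 → ℕ × ℕ}
    {r s : ℕ} (a : A) (T : TraceProduct σ τ r s) : T.wt (fun _ => a) = T.degree • a := by
  have hM : ∀ {m n : ℕ} (M : MulTerm σ τ m n), M.wt (fun _ => a) = M.degree • a := by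
    intro m n M
    induction M with
    | one => simp [MulTerm.wt, MulTerm.degree]
    | mul B M ih =>
      cases B <;> simp [MulTerm.wt, MulTerm.degree, MulFactor.wt, MulFactor.degree, ih, add_smul]
  obtain ⟨l, M⟩ := T
  simp only [TraceProduct.wt, TraceProduct.degree, add_smul, hM]
  congr 1
  induction l with
  | nil => simp
  | cons N l ih => simp [ih, add_smul]

/-- Constants have weight 0, so the gap weighs at most (2, 0); with one more layer and one G this
makes (3, 1). -/
theorem stepFun_mem (a : ℝ) (l : Layer) :
    stepFun p p₁ p₂ a l ∈ tracePolys (extSize p (layerSize p p₁ p₂)) (layerSize p p₁ p₂) extWt 0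
      (3, 1) (layerSize p p₁ p₂ l).1 (layerSize p p₁ p₂ l).2 := by
  set σ := extSize p (layerSize p p₁ p₂)
  have h1 : (fun _ X _ => X (some Layer.one) : MatrixFun σ (layerSize p p₁ p₂) p₁ p) ∈
      tracePolys σ (layerSize p p₁ p₂) extWt 0 (1, 0) p₁ p :=
    tracePolys.factor_mem (.param (some Layer.one))
  have h2 : (fun _ X _ => X (some Layer.two) : MatrixFun σ (layerSize p p₁ p₂) p₂ p₁) ∈
      tracePolys σ (layerSize p p₁ p₂) extWt 0 (1, 0) p₂ p₁ :=
    tracePolys.factor_mem (.param (some Layer.two))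
  have hG : (fun _ X _ => X none : MatrixFun σ (layerSize p p₁ p₂) p p) ∈
      tracePolys σ (layerSize p p₁ p₂) extWt 0 (0, 1) p p :=
    tracePolys.factor_mem (.param none)
  have c1 : (fun _ _ C => C Layer.one : MatrixFun σ (layerSize p p₁ p₂) p₁ p) ∈
      tracePolys σ (layerSize p p₁ p₂) extWt 0 (0, 0) p₁ p :=
    tracePolys.factor_mem (.const Layer.one)
  have c2 : (fun _ _ C => C Layer.two : MatrixFun σ (layerSize p p₁ p₂) p₂ p₁) ∈
      tracePolys σ (layerSize p p₁ p₂) extWt 0 (0, 0) p₂ p₁ :=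
    tracePolys.factor_mem (.const Layer.two)
  have hgap := tracePolys.sub_mem (tracePolys.mul_mem h2 h1)
    (tracePolys.mono le_rfl (by decide) (tracePolys.mul_mem c2 c1))
  cases l with
  | one =>
    have := tracePolys.smul_mem a
      (tracePolys.mul_mem (tracePolys.mul_mem (tracePolys.transpose_mem h2) hgap) hG)
    exact tracePolys.congr_mem (tracePolys.sub_mem
      (tracePolys.mono (Nat.zero_le _) (by decide) h1) this) le_rfl (by decide) fun _ _ _ => rfl
  | two =>
    have := tracePolys.smul_mem a
      (tracePolys.mul_mem (tracePolys.mul_mem hgap hG) (tracePolys.transpose_mem h1))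
    exact tracePolys.congr_mem (tracePolys.sub_mem
      (tracePolys.mono (Nat.zero_le _) (by decide) h2) this) le_rfl (by decide) fun _ _ _ => rfl

/-- The mean of a trace-product of the layers over one gradient step. -/
theorem exists_mean_gradientStep (a : ℝ) {D r s : ℕ}
    (T : TraceProduct (layerSize p p₁ p₂) (layerSize p p₁ p₂) r s) (hT : T.degree ≤ D) :
    ∃ H ∈ tracePolys (layerSize p p₁ p₂) (layerSize p p₁ p₂) (fun _ => 1) D (3 * D) r s,
      ∀ b : ℕ, 1 ≤ b → ∀ v w i j,
        ∫ z, T.eval (layerValue (gradientStep a v w (batchCov z))) (layerValue v) i j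
          ∂(stdGaussianPi (Fin b × Fin p)) = H (1 / (b : ℝ)) (layerValue w) (layerValue v) i j := by
  have h := tracePolys.subst (ω := fun _ => ((3, 1) : ℕ × ℕ)) (stepFun p p₁ p₂ a) (stepFun_mem a) T
  rw [TraceProduct.wt_const] at h
  have hD : T.degree • ((3, 1) : ℕ × ℕ) ≤ (3 * D, D) :=
    Prod.le_def.2 ⟨by simp; omega, by simpa using hT⟩
  obtain ⟨H, hH, h⟩ := tracePolys_le_meanSubmodule (tracePolys.mono le_rfl hD h)
  refine ⟨H, hH, fun b hb v w i j => ?_⟩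
  rw [← (h b hb (layerValue w) (layerValue v) i j).2]
  refine integral_congr_ae (Filter.Eventually.of_forall fun z => ?_)
  have e : layerValue (gradientStep a v w (batchCov z)) =
      fun l => stepFun p p₁ p₂ a l (1 / (b : ℝ)) (extEnv (batchCov z) (layerValue w))
        (layerValue v) := funext fun l => layerValue_gradientStep _ _ _ _ _ _
  simp only [e]

end GradientStep

/-! ### Measurability and moments through algebras of functions -/

section EntriesIn

variable {Ω : Type*} {S : Subalgebra ℝ (Ω → ℝ)} {m n k : ℕ}

/-- All entries of a matrix-valued function belong to an algebra of functions. -/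
def EntriesIn (S : Subalgebra ℝ (Ω → ℝ)) (F : Ω → Matrix (Fin m) (Fin n) ℝ) : Prop :=
  ∀ i j, (fun ω => F ω i j) ∈ S

namespace EntriesIn

theorem const (A : Matrix (Fin m) (Fin n) ℝ) : EntriesIn S fun _ => A :=
  fun i j => S.algebraMap_mem (A i j)

theorem sub {F G : Ω → Matrix (Fin m) (Fin n) ℝ} (hF : EntriesIn S F) (hG : EntriesIn S G) :
    EntriesIn S fun ω => F ω - G ω :=
  fun i j => S.sub_mem (hF i j) (hG i j)

theorem smul {f : Ω → ℝ} {F : Ω → Matrix (Fin m) (Fin n) ℝ} (hf : f ∈ S) (hF : EntriesIn S F) :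
    EntriesIn S fun ω => f ω • F ω :=
  fun i j => S.mul_mem hf (hF i j)

theorem sum_mem {κ : Type*} (s : Finset κ) {f : κ → Ω → ℝ} (hf : ∀ k, f k ∈ S) :
    (fun ω => ∑ k ∈ s, f k ω) ∈ S := by
  have := S.sum_mem (t := s) fun k _ => hf k
  convert this using 1
  ext ω
  simp

theorem mul {F : Ω → Matrix (Fin m) (Fin n) ℝ} {G : Ω → Matrix (Fin n) (Fin k) ℝ}
    (hF : EntriesIn S F) (hG : EntriesIn S G) : EntriesIn S fun ω => F ω * G ω := by
  intro i j
  simp only [Matrix.mul_apply]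
  exact sum_mem _ fun l => S.mul_mem (hF i l) (hG l j)

theorem transpose {F : Ω → Matrix (Fin m) (Fin n) ℝ} (hF : EntriesIn S F) :
    EntriesIn S fun ω => (F ω).transpose :=
  fun i j => hF j i

variable {𝒳 𝒞 : Type} {σ : 𝒳 → ℕ × ℕ} {τ : 𝒞 → ℕ × ℕ} {X : Ω → MatrixEnv σ}

theorem term_eval (hX : ∀ x, EntriesIn S fun ω => X ω x) (C : MatrixEnv τ) (M : MulTerm σ τ m n) :
    EntriesIn S fun ω => M.eval (X ω) C := by
  induction M with
  | one => exact const 1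
  | mul B M ih =>
    refine mul (F := fun ω => B.eval (X ω) C) ?_ ih
    cases B with
    | param x => exact hX x
    | paramT x => exact transpose (hX x)
    | const c => exact const _
    | constT c => exact const _

theorem eval (hX : ∀ x, EntriesIn S fun ω => X ω x) (C : MatrixEnv τ) (T : TraceProduct σ τ m n) :
    EntriesIn S fun ω => T.eval (X ω) C := by
  refine smul (f := fun ω => (T.traced.map fun M => (M.2.eval (X ω) C).trace).prod) ?_
    (term_eval hX C T.last)
  induction T.traced with
  | nil => exact S.one_mem
  | cons M l ih => exact S.mul_mem (sum_mem _ fun i => term_eval hX C M.2 i i) ih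

variable {p p₁ p₂ b : ℕ}

theorem gap (v : Weights p p₁ p₂) {w : Ω → Weights p p₁ p₂}
    (h₁ : EntriesIn S fun ω => (w ω).1) (h₂ : EntriesIn S fun ω => (w ω).2) :
    EntriesIn S fun ω => gap v (w ω) :=
  sub (mul h₂ h₁) (const _)

theorem batchCov {z : Ω → Fin b × Fin p → ℝ} (hz : ∀ k, (fun ω => z ω k) ∈ S) :
    EntriesIn S fun ω => batchCov (z ω) := by
  intro i j
  simp only [batchCov_apply]
  exact S.mul_mem (S.algebraMap_mem _) (sum_mem _ fun k => S.mul_mem (hz (k, i)) (hz (k, j)))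

theorem gradientStep (a : ℝ) (v : Weights p p₁ p₂) {w : Ω → Weights p p₁ p₂}
    {G : Ω → Matrix (Fin p) (Fin p) ℝ} (h₁ : EntriesIn S fun ω => (w ω).1)
    (h₂ : EntriesIn S fun ω => (w ω).2) (hG : EntriesIn S G) :
    (EntriesIn S fun ω => (gradientStep a v (w ω) (G ω)).1) ∧
      EntriesIn S fun ω => (gradientStep a v (w ω) (G ω)).2 :=
  ⟨sub h₁ (smul (S.algebraMap_mem a) (mul (mul (transpose h₂) (gap v h₁ h₂)) hG)),
    sub h₂ (smul (S.algebraMap_mem a) (mul (mul (gap v h₁ h₂) hG) (transpose h₁)))⟩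

theorem sgdWeights (α : ℕ → ℝ) (v : Weights p p₁ p₂) {w : Ω → Weights p p₁ p₂}
    {x : ℕ → Fin b → Ω → EuclideanSpace ℝ (Fin p)} (h₁ : EntriesIn S fun ω => (w ω).1)
    (h₂ : EntriesIn S fun ω => (w ω).2) (hx : ∀ u i k, (fun ω => x u i ω k) ∈ S) (t : ℕ) :
    (EntriesIn S fun ω => (sgdWeights α v (w ω) (fun u i => x u i ω) t).1) ∧
      EntriesIn S fun ω => (sgdWeights α v (w ω) (fun u i => x u i ω) t).2 := by
  induction t with
  | zero => exact ⟨h₁, h₂⟩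
  | succ t ih =>
    simp only [sgdWeights_succ]
    exact gradientStep (α t) v ih.1 ih.2 (batchCov fun k => hx t k.1 k.2)

theorem layerValue {w : Ω → Weights p p₁ p₂}
    (h₁ : EntriesIn S fun ω => (w ω).1) (h₂ : EntriesIn S fun ω => (w ω).2) (l : Layer) :
    EntriesIn S fun ω => layerValue (w ω) l := by
  cases l
  exacts [h₁, h₂]

theorem layerOrGapValue (v : Weights p p₁ p₂) {w : Ω → Weights p p₁ p₂}
    (h₁ : EntriesIn S fun ω => (w ω).1) (h₂ : EntriesIn S fun ω => (w ω).2) (l : LayerOrGap) :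
    EntriesIn S fun ω => layerOrGapValue v (w ω) l := by
  cases l
  exacts [h₁, h₂, gap v h₁ h₂]

end EntriesIn

/-- The algebra of measurable functions. -/
def measurableFunctions (Ω : Type*) [MeasurableSpace Ω] : Subalgebra ℝ (Ω → ℝ) where
  carrier := {f | Measurable f}
  mul_mem' hf hg := Measurable.mul hf hg
  add_mem' hf hg := Measurable.add hf hg
  algebraMap_mem' _ := measurable_const

/-- The algebra of functions with finite moments of every order. -/
def momentFunctions {Ω : Type*} [MeasurableSpace Ω] (P : Measure Ω) [IsFiniteMeasure P] :
    Subalgebra ℝ (Ω → ℝ) where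
  carrier := {f | ∀ n : ℕ, MemLp f n P}
  mul_mem' := by
    intro f g hf hg n
    -- Hölder with exponents 2n and 2n: having all moments, unlike having a fixed one, is stable
    -- under products.
    have : ENNReal.HolderTriple ((2 * n : ℕ) : ENNReal) ((2 * n : ℕ) : ENNReal) n := by
      constructor
      rw [Nat.cast_mul, ENNReal.mul_inv (by simp) (by simp), ← add_mul, Nat.cast_ofNat,
        ENNReal.inv_two_add_inv_two, one_mul]
    exact (hg (2 * n)).mul (hf (2 * n))
  add_mem' := fun hf hg n => (hf n).add (hg n)
  algebraMap_mem' := fun a n => memLp_const a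

theorem integrable_of_mem_momentFunctions {Ω : Type*} [MeasurableSpace Ω] {P : Measure Ω}
    [IsFiniteMeasure P] {f : Ω → ℝ} (hf : f ∈ momentFunctions P) : Integrable f P :=
  memLp_one_iff_integrable.1 (by simpa using hf 1)

end EntriesIn

/-! ### Conditioning on one of two independent variables -/

section Independence

variable {Ω 𝒰 𝒱 : Type*} [MeasurableSpace Ω] [MeasurableSpace 𝒰] [MeasurableSpace 𝒱]
  {P : Measure Ω} [IsProbabilityMeasure P] {U : Ω → 𝒰} {V : Ω → 𝒱} {F : 𝒰 × 𝒱 → ℝ}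

theorem integral_indepFun_eq_integral_integral (hUV : IndepFun U V P) (hU : AEMeasurable U P)
    (hV : AEMeasurable V P) (hF : Measurable F) (hint : Integrable (fun ω => F (U ω, V ω)) P) :
    ∫ ω, F (U ω, V ω) ∂P = ∫ ω, ∫ z, F (U ω, z) ∂(P.map V) ∂P ∧
      Integrable (fun ω => ∫ z, F (U ω, z) ∂(P.map V)) P := by
  have := Measure.isProbabilityMeasure_map hU
  have := Measure.isProbabilityMeasure_map hV
  have hmap : P.map (fun ω => (U ω, V ω)) = (P.map U).prod (P.map V) :=
    (indepFun_iff_map_prod_eq_prod_map_map hU hV).1 hUV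
  have hUV' : AEMeasurable (fun ω => (U ω, V ω)) P := hU.prodMk hV
  have hint' : Integrable F ((P.map U).prod (P.map V)) := by
    rw [← hmap, integrable_map_measure hF.aestronglyMeasurable hUV']
    exact hint
  have hsm : StronglyMeasurable fun u => ∫ z, F (u, z) ∂(P.map V) :=
    hF.stronglyMeasurable.integral_prod_right'
  constructor
  · rw [← integral_map (f := F) hUV' hF.aestronglyMeasurable, hmap, integral_prod _ hint',
      integral_map hU hsm.aestronglyMeasurable]
  · have := hint'.integral_prod_left
    exact (integrable_map_measure hsm.aestronglyMeasurable hU).1 this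

/-- The conditional expectation of a function of two independent variables, given the first. -/
theorem condExp_indepFun_eq (hUV : IndepFun U V P) (hU : Measurable U)
    (hV : AEMeasurable V P) (hF : Measurable F) (hint : Integrable (fun ω => F (U ω, V ω)) P) :
    P[fun ω => F (U ω, V ω) | MeasurableSpace.comap U inferInstance] =ᵐ[P]
      fun ω => ∫ z, F (U ω, z) ∂(P.map V) := by
  have := Measure.isProbabilityMeasure_map hV
  have hsm : StronglyMeasurable fun u => ∫ z, F (u, z) ∂(P.map V) :=
    hF.stronglyMeasurable.integral_prod_right'
  symm
  refine ae_eq_condExp_of_forall_setIntegral_eq hU.comap_le hint (fun s _ _ =>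
    (integral_indepFun_eq_integral_integral hUV hU.aemeasurable hV hF hint).2.integrableOn) ?_
    (hsm.comp_measurable (comap_measurable U)).aestronglyMeasurable
  rintro s ⟨B, hB, rfl⟩ -
  have hind : ∀ ω z, (Prod.fst ⁻¹' B).indicator F (U ω, z) =
      (U ⁻¹' B).indicator (fun ω => F (U ω, z)) ω := fun ω z => rfl
  -- The set is U⁻¹(B), so its indicator is absorbed into F and the unconditional Fubini identity
  -- applies.
  have h := (integral_indepFun_eq_integral_integral hUV hU.aemeasurable hV
    (hF.indicator (measurable_fst hB))
    ((hint.indicator (hU hB)).congr (Filter.Eventually.of_forall fun ω => rfl))).1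
  rw [← integral_indicator (hU hB), ← integral_indicator (hU hB)]
  refine Eq.trans ?_ (h.symm.trans ?_)
  · refine integral_congr_ae (Filter.Eventually.of_forall fun ω => ?_)
    by_cases hω : U ω ∈ B
    · simp [hω]
    · simp [hω]
  · rfl

end Independence

/-! ### Independence and law of the mini-batches -/

section GaussianSamples

variable {p p₁ p₂ b : ℕ}

theorem map_pi_stdGaussian : (Measure.pi fun _ : Fin b => stdGaussian (EuclideanSpace ℝ (Fin p))).map
    (fun y (k : Fin b × Fin p) => y k.1 k.2) = stdGaussianPi (Fin b × Fin p) := by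
  have hm : Measurable fun (y : Fin b → EuclideanSpace ℝ (Fin p)) (k : Fin b × Fin p) =>
      y k.1 k.2 := by fun_prop
  refine (Measure.pi_eq fun s hs => ?_).symm
  have hE : ∀ k, MeasurableSet {e : EuclideanSpace ℝ (Fin p) | ∀ i, e i ∈ s (k, i)} := by
    intro k
    rw [Set.ofPred_forall]
    exact MeasurableSet.iInter fun i => (hs (k, i)).preimage (by fun_prop)
  have hpre : (fun (y : Fin b → EuclideanSpace ℝ (Fin p)) (k : Fin b × Fin p) => y k.1 k.2) ⁻¹'
      Set.univ.pi s = Set.univ.pi fun k => {e | ∀ i, e i ∈ s (k, i)} := by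
    ext y
    simp [Set.mem_pi]
  rw [Measure.map_apply hm (MeasurableSet.univ_pi hs), hpre, Measure.pi_pi,
    Fintype.prod_prod_type]
  refine Finset.prod_congr rfl fun k _ => ?_
  rw [← map_pi_eq_stdGaussian, Measure.map_apply (by fun_prop) (hE k), ← Measure.pi_pi]
  congr 1
  ext y
  simp [Set.mem_pi]

/-- A family of independent mini-batches of size `b` of standard Gaussian vectors. -/
structure IsGaussianSample {Ω : Type*} [MeasurableSpace Ω] (P : Measure Ω)
    (x : ℕ → Fin b → Ω → EuclideanSpace ℝ (Fin p)) : Prop where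
  hasLaw : ∀ u i, HasLaw (x u i) (stdGaussian (EuclideanSpace ℝ (Fin p))) P
  indep : iIndepFun (fun ui : ℕ × Fin b => x ui.1 ui.2) P

theorem measurable_matrix {Ω : Type*} [MeasurableSpace Ω] {m n : ℕ}
    {F : Ω → Matrix (Fin m) (Fin n) ℝ} :
    Measurable F ↔ EntriesIn (measurableFunctions Ω) F := by
  constructor
  · intro h i j
    exact (measurable_pi_apply j).comp ((measurable_pi_apply i).comp h)
  · intro h
    exact measurable_pi_lambda _ fun i => measurable_pi_lambda _ fun j => h i j

theorem measurable_sgdWeights {Ω : Type*} [MeasurableSpace Ω] (α : ℕ → ℝ) (v : Weights p p₁ p₂)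
    {w : Ω → Weights p p₁ p₂} {x : ℕ → Fin b → Ω → EuclideanSpace ℝ (Fin p)} (hw : Measurable w)
    (hx : ∀ u i, Measurable (x u i)) (t : ℕ) :
    Measurable fun ω => sgdWeights α v (w ω) (fun u i => x u i ω) t := by
  have h := EntriesIn.sgdWeights (S := measurableFunctions Ω) α v (measurable_matrix.1 hw.fst)
    (measurable_matrix.1 hw.snd) (x := x) (fun u i k => by
      have := hx u i
      exact (by fun_prop : Measurable fun ω => x u i ω k)) t
  exact (measurable_matrix.2 h.1).prodMk (measurable_matrix.2 h.2)

namespace IsGaussianSample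

variable {Ω : Type*} [MeasurableSpace Ω] {P : Measure Ω}
  {x : ℕ → Fin b → Ω → EuclideanSpace ℝ (Fin p)}

theorem coord_mem [IsFiniteMeasure P] (hx : IsGaussianSample P x) (u : ℕ) (i : Fin b) (k : Fin p) :
    (fun ω => x u i ω k) ∈ momentFunctions P := by
  intro n
  have h := IsGaussian.memLp_dual (stdGaussian (EuclideanSpace ℝ (Fin p)))
    (EuclideanSpace.proj k) n (by simp)
  rw [← (hx.hasLaw u i).map_eq] at h
  exact h.comp_of_map (hx.hasLaw u i).aemeasurable

theorem hasLaw_batch (hx : IsGaussianSample P x) (t : ℕ) :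
    HasLaw (fun ω (k : Fin b × Fin p) => x t k.1 ω k.2) (stdGaussianPi (Fin b × Fin p)) P := by
  have h := (hx.indep.precomp (g := fun i : Fin b => (t, i))
    (fun i j hij => (Prod.ext_iff.1 hij).2)).hasLaw_pi fun i => hx.hasLaw t i
  have h2 : HasLaw (fun (y : Fin b → EuclideanSpace ℝ (Fin p)) (k : Fin b × Fin p) => y k.1 k.2)
      (stdGaussianPi (Fin b × Fin p))
      (Measure.pi fun _ : Fin b => stdGaussian (EuclideanSpace ℝ (Fin p))) :=
    ⟨Measurable.aemeasurable (by fun_prop), map_pi_stdGaussian⟩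
  exact h2.comp h

theorem aemeasurable (hx : IsGaussianSample P x) :
    AEMeasurable (fun ω (ui : ℕ × Fin b) => x ui.1 ui.2 ω) P :=
  aemeasurable_pi_lambda _ fun ui => (hx.hasLaw ui.1 ui.2).aemeasurable

theorem aemeasurable_sgdWeights (hx : IsGaussianSample P x) (α : ℕ → ℝ) (v w : Weights p p₁ p₂)
    (t : ℕ) : AEMeasurable (fun ω => sgdWeights α v w (fun u i => x u i ω) t) P :=
  (measurable_sgdWeights (Ω := ℕ × Fin b → EuclideanSpace ℝ (Fin p)) α v (w := fun _ => w)
    (x := fun u i y => y (u, i)) measurable_const (fun _ _ => measurable_pi_apply _)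
    t).comp_aemeasurable hx.aemeasurable

/-- The weights after `t` steps are independent of the next mini-batch. -/
theorem indepFun_sgdWeights (hx : IsGaussianSample P x) (α : ℕ → ℝ) (v w : Weights p p₁ p₂)
    (t : ℕ) : IndepFun (fun ω => sgdWeights α v w (fun u i => x u i ω) t)
      (fun ω (k : Fin b × Fin p) => x t k.1 ω k.2) P := by
  classical
  have h := hx.indep.indepFun_finset₀ (Finset.range t ×ˢ Finset.univ) ({t} ×ˢ Finset.univ)
    (by
      rw [Finset.disjoint_left]
      rintro ⟨u, i⟩ h1 h2
      simp at h1 h2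
      omega) fun ui => (hx.hasLaw ui.1 ui.2).aemeasurable
  -- The weights after t steps as a function of the samples before time t alone; later samples are
  -- never read and are set to 0.
  have hg : Measurable fun y : (Finset.range t ×ˢ (Finset.univ : Finset (Fin b)) :
      Finset (ℕ × Fin b)) → EuclideanSpace ℝ (Fin p) =>
      sgdWeights α v w (fun u i => if h : (u, i) ∈ Finset.range t ×ˢ Finset.univ then
        y ⟨(u, i), h⟩ else 0) t := by
    refine measurable_sgdWeights α v measurable_const (fun u i => ?_) t
    by_cases h : (u, i) ∈ Finset.range t ×ˢ Finset.univ
    · simpa only [dif_pos h] using measurable_pi_apply _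
    · simpa only [dif_neg h] using measurable_const
  have hz : Measurable fun (y : ({t} ×ˢ (Finset.univ : Finset (Fin b)) : Finset (ℕ × Fin b)) →
      EuclideanSpace ℝ (Fin p)) (k : Fin b × Fin p) => y ⟨(t, k.1), by simp⟩ k.2 := by fun_prop
  have := h.comp hg hz
  refine this.congr (Filter.Eventually.of_forall fun ω => ?_)
    (Filter.Eventually.of_forall fun ω => rfl)
  symm
  refine sgdWeights_congr α v w t fun u hu => ?_
  ext1 i
  rw [dif_pos (by simpa using hu)]

variable [IsProbabilityMeasure P]

theorem entriesIn_sgdWeights (hx : IsGaussianSample P x) (α : ℕ → ℝ) (v w : Weights p p₁ p₂)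
    (t : ℕ) (l : Layer) : EntriesIn (momentFunctions P)
      fun ω => layerValue (sgdWeights α v w (fun u i => x u i ω) t) l :=
  have h := EntriesIn.sgdWeights α v (EntriesIn.const w.1) (EntriesIn.const w.2) hx.coord_mem t
  EntriesIn.layerValue h.1 h.2 l

/-- The last batch is independent of the weights it acts on, so it is integrated out first. -/
theorem integral_sgdWeights_succ (hx : IsGaussianSample P x) (α : ℕ → ℝ) (v w : Weights p p₁ p₂)
    (t : ℕ) {r s : ℕ} (T : TraceProduct (layerSize p p₁ p₂) (layerSize p p₁ p₂) r s)
    (i : Fin r) (j : Fin s) :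
    ∫ ω, T.eval (layerValue (sgdWeights α v w (fun u i => x u i ω) (t + 1))) (layerValue v) i j ∂P =
      ∫ ω, ∫ z, T.eval (layerValue (gradientStep (α t) v
        (sgdWeights α v w (fun u i => x u i ω) t) (batchCov z))) (layerValue v) i j
          ∂(stdGaussianPi (Fin b × Fin p)) ∂P := by
  have hF : Measurable fun q : Weights p p₁ p₂ × (Fin b × Fin p → ℝ) =>
      T.eval (layerValue (gradientStep (α t) v q.1 (batchCov q.2))) (layerValue v) i j := by
    have h := EntriesIn.gradientStep
      (S := measurableFunctions (Weights p p₁ p₂ × (Fin b × Fin p → ℝ))) (α t) v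
      (measurable_matrix.1 measurable_fst.fst) (measurable_matrix.1 measurable_fst.snd)
      (EntriesIn.batchCov (z := Prod.snd) fun k =>
        show Measurable fun q : Weights p p₁ p₂ × (Fin b × Fin p → ℝ) => q.2 k by fun_prop)
    exact EntriesIn.eval (EntriesIn.layerValue h.1 h.2) (layerValue v) T i j
  have h := (integral_indepFun_eq_integral_integral (hx.indepFun_sgdWeights α v w t)
    (hx.aemeasurable_sgdWeights α v w t) (hx.hasLaw_batch t).aemeasurable hF (by
      have := integrable_of_mem_momentFunctions
        (EntriesIn.eval (hx.entriesIn_sgdWeights α v w (t + 1)) (layerValue v) T i j)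
      simpa only [sgdWeights_succ] using this)).1
  rw [(hx.hasLaw_batch t).map_eq] at h
  simpa only [sgdWeights_succ] using h

end IsGaussianSample

end GaussianSamples

/-! ### Iteration over the steps -/

section SgdMean

universe u

variable {p p₁ p₂ : ℕ} {α : ℕ → ℝ} {t : ℕ} {r s : ℕ}

/-- `H` gives the mean of `F` over the weights after `t` steps of stochastic gradient descent from
fixed initial weights. -/
def HasSgdMean (α : ℕ → ℝ) (t : ℕ)
    (F H : MatrixFun (layerSize p p₁ p₂) (layerSize p p₁ p₂) r s) : Prop :=
  ∀ b : ℕ, 1 ≤ b → ∀ {Ω : Type u} [MeasurableSpace Ω] (P : Measure Ω) [IsProbabilityMeasure P]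
    (x : ℕ → Fin b → Ω → EuclideanSpace ℝ (Fin p)), IsGaussianSample P x →
    ∀ (v w : Weights p p₁ p₂) i j,
      Integrable (fun ω => F (1 / (b : ℝ))
        (layerValue (sgdWeights α v w (fun u i => x u i ω) t)) (layerValue v) i j) P ∧
      ∫ ω, F (1 / (b : ℝ)) (layerValue (sgdWeights α v w (fun u i => x u i ω) t))
        (layerValue v) i j ∂P = H (1 / (b : ℝ)) (layerValue w) (layerValue v) i j

namespace HasSgdMean

variable {F H F' H' : MatrixFun (layerSize p p₁ p₂) (layerSize p p₁ p₂) r s}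

theorem add (h : HasSgdMean.{u} α t F H) (h' : HasSgdMean.{u} α t F' H') :
    HasSgdMean.{u} α t (F + F') (H + H') := by
  intro b hb Ω _ P _ x hx v w i j
  obtain ⟨h1, h2⟩ := h b hb P x hx v w i j
  obtain ⟨h3, h4⟩ := h' b hb P x hx v w i j
  refine ⟨h1.add h3, (integral_add h1 h3).trans ?_⟩
  rw [h2, h4]
  rfl

theorem mul_smul {f : ℝ → ℝ} (h : HasSgdMean.{u} α t F H) :
    HasSgdMean.{u} α t (fun β X C => f β • F β X C) (fun β X C => f β • H β X C) := by
  intro b hb Ω _ P _ x hx v w i j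
  obtain ⟨h1, h2⟩ := h b hb P x hx v w i j
  refine ⟨h1.const_mul _, (integral_const_mul _ _).trans ?_⟩
  rw [h2]
  rfl

theorem zero :
    HasSgdMean.{u} α t (0 : MatrixFun (layerSize p p₁ p₂) (layerSize p p₁ p₂) r s) 0 := by
  intro b hb Ω _ P _ x hx v w i j
  simp

end HasSgdMean

/-- The mean of a combination of trace-products after `t` steps is again such a combination. -/
theorem exists_hasSgdMean (α : ℕ → ℝ) (t : ℕ) {K D : ℕ}
    {F : MatrixFun (layerSize p p₁ p₂) (layerSize p p₁ p₂) r s}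
    (hF : F ∈ tracePolys (layerSize p p₁ p₂) (layerSize p p₁ p₂) (fun _ => 1) K D r s) :
    ∃ H ∈ tracePolys (layerSize p p₁ p₂) (layerSize p p₁ p₂) (fun _ => 1)
      (K + (3 ^ t - 1) * D) (3 ^ t * D) r s, HasSgdMean.{u} α t F H := by
  induction t generalizing K D F with
  | zero =>
    refine ⟨F, tracePolys.mono (by simp) (by simp) hF, ?_⟩
    intro b hb Ω _ P _ x hx v w i j
    simp [sgdWeights]
  | succ t ih =>
    induction hF using Submodule.span_induction with
    | mem F hF =>
      obtain ⟨k, T, hk, hT, rfl⟩ := hF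
      rw [TraceProduct.wt_one_eq_degree] at hT
      -- The last step is averaged first; the result, of weight at most 3D, is then passed to the
      -- first t steps.
      obtain ⟨H₁, hH₁, hmean⟩ := exists_mean_gradientStep (p := p) (p₁ := p₁) (p₂ := p₂) (α t) T hT
      obtain ⟨H, hH, hmean'⟩ := ih hH₁
      refine ⟨_, tracePolys.mono ?_ ?_ (tracePolys.pow_smul_mem k hH),
        HasSgdMean.mul_smul (f := fun β => β ^ k) (H := H) ?_⟩
      -- The powers of β add up to D + (3^t - 1)·3D + k, which is at most K + (3^(t+1) - 1)·D.
      · have : 1 ≤ 3 ^ t := Nat.one_le_pow _ _ (by norm_num)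
        obtain ⟨c, hc⟩ := Nat.exists_eq_add_of_le this
        rw [pow_succ, hc, show (1 + c) * 3 - 1 = 3 * c + 2 by omega, Nat.add_sub_cancel_left]
        nlinarith
      · rw [pow_succ, mul_assoc]
      · intro b hb Ω _ P _ x hx v w i j
        refine ⟨integrable_of_mem_momentFunctions
          (EntriesIn.eval (hx.entriesIn_sgdWeights α v w (t + 1)) (layerValue v) T i j), ?_⟩
        rw [hx.integral_sgdWeights_succ]
        simp only [hmean b hb]
        exact (hmean' b hb P x hx v w i j).2
    | zero => exact ⟨0, Submodule.zero_mem _, HasSgdMean.zero⟩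
    | add F G _ _ hF hG =>
      obtain ⟨H, hH, h⟩ := hF
      obtain ⟨I, hI, h'⟩ := hG
      exact ⟨_, Submodule.add_mem _ hH hI, h.add h'⟩
    | smul a F _ hF =>
      obtain ⟨H, hH, h⟩ := hF
      exact ⟨_, Submodule.smul_mem _ a hH, h.mul_smul (f := fun _ => a)⟩

end SgdMean

/-! ### Extraction of coefficients -/

section Coefficients

variable {𝒳 𝒞 : Type} {σ : 𝒳 → ℕ × ℕ} {τ : 𝒞 → ℕ × ℕ} {r s : ℕ}

/-- The coefficients of a combination of trace-products, sorted by powers. -/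
theorem tracePolys.exists_coefficients {K D : ℕ} (T₀ : TraceProduct σ τ r s)
    {H : MatrixFun σ τ r s} (hH : H ∈ tracePolys σ τ (fun _ => 1) K D r s) :
    ∃ (m : ℕ → ℕ) (a : ℕ → ℕ → ℝ) (T : ℕ → ℕ → TraceProduct σ τ r s),
      (∀ k ≤ K, ∀ i < m k, (T k i).degree ≤ D) ∧
      ∀ β X C, H β X C = ∑ k ∈ Finset.range (K + 1), β ^ k •
        ∑ i ∈ Finset.range (m k), a k i • (T k i).eval X C := by
  induction hH using Submodule.span_induction with
  | mem H hH =>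
    obtain ⟨k, T, hk, hT, rfl⟩ := hH
    rw [TraceProduct.wt_one_eq_degree] at hT
    refine ⟨fun l => if l = k then 1 else 0, fun _ _ => 1, fun _ _ => T, fun _ _ _ _ => hT,
      fun β X C => ?_⟩
    rw [Finset.sum_eq_single k]
    · simp
    · intro l _ hl
      simp [hl]
    · intro h
      exact absurd (Finset.mem_range.2 (Nat.lt_succ_of_le hk)) h
  | zero => exact ⟨fun _ => 0, fun _ _ => 0, fun _ _ => T₀, by simp, by simp⟩
  | add H I _ _ hH hI =>
    obtain ⟨m, a, T, h1, h2⟩ := hH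
    obtain ⟨m', a', T', h3, h4⟩ := hI
    refine ⟨fun k => m k + m' k, fun k i => if i < m k then a k i else a' k (i - m k),
      fun k i => if i < m k then T k i else T' k (i - m k), fun k hk i hi => ?_, fun β X C => ?_⟩
    · by_cases h : i < m k
      · simpa only [if_pos h] using h1 k hk i h
      · simpa only [if_neg h] using h3 k hk (i - m k) (by have : i < m k + m' k := hi; omega)
    · refine (congrArg₂ (· + ·) (h2 β X C) (h4 β X C)).trans ?_
      simp only
      rw [← Finset.sum_add_distrib]
      refine Finset.sum_congr rfl fun k _ => ?_
      rw [← smul_add, Finset.sum_range_add]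
      congr 2
      · refine Finset.sum_congr rfl fun i hi => ?_
        rw [if_pos (Finset.mem_range.1 hi), if_pos (Finset.mem_range.1 hi)]
      · refine Finset.sum_congr rfl fun i _ => ?_
        rw [if_neg (by omega), if_neg (by omega), Nat.add_sub_cancel_left]
  | smul c H _ hH =>
    obtain ⟨m, a, T, h1, h2⟩ := hH
    refine ⟨m, fun k i => c * a k i, T, h1, fun β X C => ?_⟩
    refine (congrArg (c • ·) (h2 β X C)).trans ?_
    simp only [Finset.smul_sum, smul_smul]
    refine Finset.sum_congr rfl fun k _ => Finset.sum_congr rfl fun i _ => ?_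
    congr 1
    ring

end Coefficients

/-! ### Elimination of the gap and the main theorem -/

section GapSubstitution

variable {p p₁ p₂ r s : ℕ}

/-- The weights of the layers and of the gap. -/
def layerOrGapWt : LayerOrGap → ℕ
  | .one => 1
  | .two => 1
  | .gap => 2

theorem TraceProduct.wt_layerOrGapWt {σ : LayerOrGap → ℕ × ℕ} {𝒞 : Type} {τ : 𝒞 → ℕ × ℕ}
    (T : TraceProduct σ τ r s) :
    T.wt layerOrGapWt = T.degOf .one + T.degOf .two + 2 * T.degOf .gap := by
  have hM : ∀ {m n : ℕ} (M : MulTerm σ τ m n),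
      M.wt layerOrGapWt = M.degOf .one + M.degOf .two + 2 * M.degOf .gap := by
    intro m n M
    induction M with
    | one => rfl
    | mul B M ih =>
      have hB : B.wt layerOrGapWt = B.degOf .one + B.degOf .two + 2 * B.degOf .gap := by
        cases B with
        | param x | paramT x => cases x <;> rfl
        | const c | constT c => rfl
      simp only [MulTerm.wt, MulTerm.degOf, ih, hB]
      ring
  obtain ⟨l, M⟩ := T
  simp only [TraceProduct.wt, TraceProduct.degOf, hM]
  induction l with
  | nil => simp
  | cons N l ih =>
    simp only [List.map_cons, List.sum_cons]
    linarith

/-- The layers and the gap as functions of the layers. -/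
def gapFun (p p₁ p₂ : ℕ) : ∀ l, MatrixFun (layerSize p p₁ p₂) (layerSize p p₁ p₂)
    (layerOrGapSize p p₁ p₂ l).1 (layerOrGapSize p p₁ p₂ l).2 :=
  fun l _ X C => layerOrGapValue (C .one, C .two) (X .one, X .two) l

theorem gapFun_mem (l : LayerOrGap) :
    gapFun p p₁ p₂ l ∈ tracePolys (layerSize p p₁ p₂) (layerSize p p₁ p₂) (fun _ => 1) 0
      (layerOrGapWt l) (layerOrGapSize p p₁ p₂ l).1 (layerOrGapSize p p₁ p₂ l).2 := by
  set σ := layerSize p p₁ p₂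
  have h1 : (fun _ X _ => X Layer.one : MatrixFun σ σ p₁ p) ∈
      tracePolys σ σ (fun _ => 1) 0 1 p₁ p :=
    tracePolys.factor_mem (.param Layer.one)
  have h2 : (fun _ X _ => X Layer.two : MatrixFun σ σ p₂ p₁) ∈
      tracePolys σ σ (fun _ => 1) 0 1 p₂ p₁ :=
    tracePolys.factor_mem (.param Layer.two)
  have c1 : (fun _ _ C => C Layer.one : MatrixFun σ σ p₁ p) ∈
      tracePolys σ σ (fun _ => 1) 0 0 p₁ p :=
    tracePolys.factor_mem (.const Layer.one)
  have c2 : (fun _ _ C => C Layer.two : MatrixFun σ σ p₂ p₁) ∈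
      tracePolys σ σ (fun _ => 1) 0 0 p₂ p₁ :=
    tracePolys.factor_mem (.const Layer.two)
  cases l with
  | one => exact h1
  | two => exact h2
  | gap =>
    have h := tracePolys.mul_mem h2 h1
    have hc := tracePolys.mono (le_refl _) (show 0 + 0 ≤ 1 + 1 by decide) (tracePolys.mul_mem c2 c1)
    exact tracePolys.congr_mem (tracePolys.sub_mem h hc) le_rfl le_rfl fun _ _ _ => rfl

/-- Supplies the default term for the coefficient extraction: formally, W₂W₁ has the size of the
gap. -/
theorem nonempty_layerTerm {m n : ℕ}
    (M : MulTerm (layerOrGapSize p p₁ p₂) (layerSize p p₁ p₂) m n) :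
    Nonempty (MulTerm (layerSize p p₁ p₂) (layerSize p p₁ p₂) m n) := by
  induction M with
  | one n => exact ⟨.one n⟩
  | mul B M ih =>
    obtain ⟨N⟩ := ih
    cases B with
    | param x =>
      cases x with
      | one => exact ⟨.mul (.param Layer.one) N⟩
      | two => exact ⟨.mul (.param Layer.two) N⟩
      | gap => exact ⟨.mul (.param Layer.two) (.mul (.param Layer.one) N)⟩
    | paramT x =>
      cases x with
      | one => exact ⟨.mul (.paramT Layer.one) N⟩
      | two => exact ⟨.mul (.paramT Layer.two) N⟩
      | gap => exact ⟨.mul (.paramT Layer.one) (.mul (.paramT Layer.two) N)⟩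
    | const c => exact ⟨.mul (.const c) N⟩
    | constT c => exact ⟨.mul (.constT c) N⟩

end GapSubstitution

theorem mainTheorem5 (p p₁ p₂ : ℕ) (α : ℕ → ℝ) (t : ℕ) {r s : ℕ}
    (M : TraceProduct (layerOrGapSize p p₁ p₂) (layerSize p p₁ p₂) r s) (d d' : ℕ)
    (hd : M.degOf .one + M.degOf .two = d) (hd' : M.degOf .gap = d') :
    ∃ (q : ℕ) (m : ℕ → ℕ) (a : ℕ → ℕ → ℝ)
      (T : ℕ → ℕ → TraceProduct (layerSize p p₁ p₂) (layerSize p p₁ p₂) r s),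
      q ≤ 3 ^ t * (d + 2 * d') ∧
      (∀ k ≤ q, ∀ i < m k, (T k i).degree ≤ 3 ^ t * (d + 2 * d')) ∧
      ∀ (v : Weights p p₁ p₂) (b : ℕ), 1 ≤ b →
      ∀ {Ω : Type*} [MeasurableSpace Ω] (P : Measure Ω) [IsProbabilityMeasure P]
        (W₀ : Ω → Weights p p₁ p₂) (x : ℕ → Fin b → Ω → EuclideanSpace ℝ (Fin p)),
        Measurable W₀ →
        (∀ u i, HasLaw (x u i) (stdGaussian (EuclideanSpace ℝ (Fin p))) P) →
        iIndepFun (fun ui : ℕ × Fin b => x ui.1 ui.2) P →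
        IndepFun W₀ (fun ω (ui : ℕ × Fin b) => x ui.1 ui.2 ω) P →
        let W : Ω → Weights p p₁ p₂ := fun ω => sgdWeights α v (W₀ ω) (fun u i => x u i ω) t
        let Mt : Ω → Matrix (Fin r) (Fin s) ℝ :=
          fun ω => M.eval (layerOrGapValue v (W ω)) (layerValue v)
        let N : ℕ → Ω → Matrix (Fin r) (Fin s) ℝ := fun k ω =>
          ∑ i ∈ Finset.range (m k), a k i • (T k i).eval (layerValue (W₀ ω)) (layerValue v)
        ((∀ n : ℕ, (∀ i j, MemLp (fun ω => (W₀ ω).1 i j) n P) ∧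
            (∀ i j, MemLp (fun ω => (W₀ ω).2 i j) n P)) →
          ∀ i j, Integrable (fun ω => Mt ω i j) P) ∧
        ∀ i j, Integrable (fun ω => Mt ω i j) P →
          P[fun ω => Mt ω i j | MeasurableSpace.comap W₀ inferInstance] =ᵐ[P]
            fun ω => (∑ k ∈ Finset.range (q + 1), (1 / (b : ℝ) ^ k) • N k ω) i j := by
  have hF := tracePolys.subst (ω := layerOrGapWt) (gapFun p p₁ p₂) gapFun_mem M
  rw [TraceProduct.wt_layerOrGapWt, hd, hd'] at hF
  obtain ⟨H, hH, hmean⟩ := exists_hasSgdMean α t hF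
  obtain ⟨M₀⟩ := nonempty_layerTerm M.last
  obtain ⟨m, a, T, hT, hsum⟩ := tracePolys.exists_coefficients ⟨[], M₀⟩ hH
  refine ⟨0 + (3 ^ t - 1) * (d + 2 * d'), m, a, T, ?_, hT, ?_⟩
  · rw [zero_add]
    exact Nat.mul_le_mul_right _ (Nat.sub_le _ _)
  intro v b hb Ω _ P _ W₀ x hW₀ hlaw hindep hW₀x W Mt N
  have hx : IsGaussianSample P x := ⟨hlaw, hindep⟩
  constructor
  · intro hmom i j
    have h := EntriesIn.sgdWeights (S := momentFunctions P) α v (fun i j n => (hmom n).1 i j)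
      (fun i j n => (hmom n).2 i j) hx.coord_mem t
    exact integrable_of_mem_momentFunctions
      (EntriesIn.eval (EntriesIn.layerOrGapValue v h.1 h.2) (layerValue v) M i j)
  · intro i j hint
    have hmeas : Measurable fun y : Weights p p₁ p₂ × (ℕ × Fin b → EuclideanSpace ℝ (Fin p)) =>
        M.eval (layerOrGapValue v (sgdWeights α v y.1 (fun u i => y.2 (u, i)) t))
          (layerValue v) i j := by
      have h := measurable_sgdWeights α v
        (w := (Prod.fst : Weights p p₁ p₂ × (ℕ × Fin b → EuclideanSpace ℝ (Fin p)) → _))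
        (x := fun u i y => y.2 (u, i)) measurable_fst (fun _ _ => by fun_prop) t
      exact EntriesIn.eval (EntriesIn.layerOrGapValue v (measurable_matrix.1 h.fst)
        (measurable_matrix.1 h.snd)) (layerValue v) M i j
    -- Conditioning freezes the initial weights at `W₀ ω`, where the mean formula for deterministic
    -- initial weights holds. The moments of `W₀` play no part here, only the integrability of this
    -- entry.
    refine (condExp_indepFun_eq hW₀x hW₀ hx.aemeasurable hmeas hint).trans
      (Filter.Eventually.of_forall fun ω => ?_)
    have h := (hmean b hb P x hx v (W₀ ω) i j).2
    rw [hsum] at h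
    simp only [one_div_pow] at h
    refine (integral_map hx.aemeasurable
      (hmeas.comp measurable_prodMk_left).aestronglyMeasurable).trans ?_
    exact h
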